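/- Theorem 4.2 ($\Gamma$-convergence of the discrete energy). Let $p>1$ and let $\Omega\subseteq\mathbb R$ be either $\mathbb R$ or a compact interval $[a,b]$ with $a<b$. Let $\mathcal P_p(\Omega)$ be the set of Borel probability measures on $\Omega$ with finite $p$-th moment, and let $W_p$ be the $p$-Wasserstein distance, $W_p(\mu,\nu)=\inf_\pi\big(\int|x-y|^p\,d\pi(x,y)\big)^{1/p}$ over all couplings $\pi$ of $\mu,\nu$. Let $H:[0,\infty)\to[0,\infty)$ be convex, continuous on $[0,\infty)$ and $C^\infty$ on $(0,\infty)$, with $H(0)=0$ and $H(x)/x\to\infty$ as $x\to\infty$. Assume that there is a constant $A>0$ with $H(x+y)\le A(1+H(x)+H(y))$ for all $x,y\ge0$, and that $x\mapsto xH(x^{-1})$ is strictly convex and non-increasing on $(0,\infty)$. Assume moreover that there are continuous functions $f_1,f_2:[0,\infty)\to\mathbb R$ with $f_1(1)=1$, $f_2(1)=0$ and $$H(\alpha x)\le f_1(\alpha)H(x)+f_2(\alpha)x\qquad\text{for all }x,\alpha\in[0,\infty).$$ For $\mu\in\mathcal P_p(\Omega)$ put $E(\mu)=\int_\Omega H(\rho(x))\,dx$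 if $\mu=\rho\,dx$ is absolutely continuous with respect to Lebesgue measure, and $E(\mu)=+\infty$ otherwise. For $N\ge2$ let $\mathcal A_N(\Omega)$ be the set of measures $\mu=\frac1N\sum_{i=1}^N\delta_{x_i}$ with $x_1<\dots<x_N$ in $\Omega$, and for such $\mu$ put $$E_N(\mu)=\sum_{i=1}^N|B_i|\,H\!\left(\frac1{N|B_i|}\right),$$ where $B_i$ is the open ball (interval) in $\mathbb R$ with centre $x_i$ and radius $\frac12\min_{j\ne i}|x_i-x_j|$, and $|B_i|$ is its length. Then $(E_N)_{N\ge2}$ $\Gamma$-converges to $E$ with respect to $W_p$, i.e. for every $\rho\in\mathcal P_p(\Omega)$: (i) for every sequence $(\mu_N)_{N\ge2}$ with $\mu_N\in\mathcal A_N(\Omega)$ and $W_p(\mu_N,\rho)\to0$, one has $E(\rho)\le\liminf_{N\to\infty}E_N(\mu_N)$; (ii) there is a sequence $(\mu_N)_{N\ge2}$ with $\mu_N\in\mathcal A_N(\Omega)$, $W_p(\mu_N,\rho)\to0$ and $\limsup_{N\to\infty}E_N(\mu_N)\le E(\rho)$. -/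

import Mathlib

open Set Filter Topology MeasureTheory
open scoped ENNReal

noncomputable section

namespace ParticleGamma

/-- The admissible one-dimensional domains: the whole line, or the closure `[a, b]` of a
(nonempty) bounded open interval. -/
def IsAdmissibleDomain (Ω : Set ℝ) : Prop :=
  Ω = univ ∨ ∃ a b : ℝ, a < b ∧ Ω = Icc a b

/-- The standing hypothesis on the internal energy density `H : [0, ∞) → ℝ` in dimension one.
Only the values of `H` on `[0, ∞)` matter; properness is automatic as `H` is real-valued. -/
structure IsEnergyDensity (H : ℝ → ℝ) : Prop where
  convex : ConvexOn ℝ (Ici 0) H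
  nonneg : ∀ x, 0 ≤ x → 0 ≤ H x
  smooth : ContDiffOn ℝ (⊤ : ℕ∞) H (Ioi 0)
  continuous : ContinuousOn H (Ici 0)
  superlinear : Tendsto (fun x => H x / x) atTop atTop
  map_zero : H 0 = 0
  doubling : ∃ A : ℝ, 0 < A ∧ ∀ x y, 0 ≤ x → 0 ≤ y → H (x + y) ≤ A * (1 + H x + H y)
  strictConvex_h : StrictConvexOn ℝ (Ioi 0) (fun x => x * H x⁻¹)
  antitone_h : AntitoneOn (fun x => x * H x⁻¹) (Ioi 0)

/-- The scaling condition `H (α x) ≤ f₁(α) H(x) + f₂(α) x` for all `x, α ≥ 0`. -/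
def ScalingCondition (H : ℝ → ℝ) : Prop :=
  ∃ f₁ f₂ : ℝ → ℝ, ContinuousOn f₁ (Ici 0) ∧ ContinuousOn f₂ (Ici 0) ∧ f₁ 1 = 1 ∧ f₂ 1 = 0 ∧
    ∀ x α : ℝ, 0 ≤ x → 0 ≤ α → H (α * x) ≤ f₁ α * H x + f₂ α * x

/-- `𝒫_p(Ω)`: Borel probability measures on `ℝ` that are concentrated on `Ω` and have finite
`p`-th moment. -/
def ProbP (p : ℝ) (Ω : Set ℝ) : Set (Measure ℝ) :=
  {μ | IsProbabilityMeasure μ ∧ μ Ωᶜ = 0 ∧ ∫⁻ x, ‖x‖ₑ ^ p ∂μ < ∞}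

/-- The set of couplings (transport plans) of `μ` and `ν`. -/
def Couplings (μ ν : Measure ℝ) : Set (Measure (ℝ × ℝ)) :=
  {π | IsProbabilityMeasure π ∧ π.map Prod.fst = μ ∧ π.map Prod.snd = ν}

/-- The `p`-Wasserstein distance (with values in `[0, ∞]`). -/
def wassersteinDist (p : ℝ) (μ ν : Measure ℝ) : ℝ≥0∞ :=
  ⨅ π ∈ Couplings μ ν, (∫⁻ z, edist z.1 z.2 ^ p ∂π) ^ (1 / p)

open scoped Classical in
/-- The continuum energy `E(μ) = ∫_Ω H(ρ(x)) dx` if `μ = ρ dx`, and `+∞` otherwise. It takes values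
in `[0, ∞]`, as it is only used for `H ≥ 0` on `[0, ∞)`. -/
def energy (H : ℝ → ℝ) (Ω : Set ℝ) (μ : Measure ℝ) : ℝ≥0∞ :=
  if μ ≪ volume then ∫⁻ x in Ω, ENNReal.ofReal (H (μ.rnDeriv volume x).toReal) else ∞

/-- The empirical measure `(1/N) ∑ᵢ δ_{xᵢ}`. -/
def empirical {N : ℕ} (x : Fin N → ℝ) : Measure ℝ :=
  (N : ℝ≥0∞)⁻¹ • ∑ i, Measure.dirac (x i)

/-- `𝒜_N(Ω)`: empirical measures of `N` particles of `Ω`, which are assumed to be distinct and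
sorted increasingly. -/
def Atomic (N : ℕ) (Ω : Set ℝ) : Set (Measure ℝ) :=
  {μ | ∃ x : Fin N → ℝ, StrictMono x ∧ (∀ i, x i ∈ Ω) ∧ μ = empirical x}

/-- The ball `Bᵢ` with centre `xᵢ` and radius `½ min_{j ≠ i} |xᵢ - xⱼ|`. -/
def particleBall {N : ℕ} (x : Fin N → ℝ) (i : Fin N) : Set ℝ :=
  Metric.ball (x i) ((⨅ j : {j : Fin N // j ≠ i}, |x i - x j|) / 2)

/-- The discrete energy as a function of the particles: `∑ᵢ |Bᵢ| H(1 / (N |Bᵢ|))`. -/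
def particleEnergy (H : ℝ → ℝ) {N : ℕ} (x : Fin N → ℝ) : ℝ :=
  ∑ i, volume.real (particleBall x i) * H (1 / (N * volume.real (particleBall x i)))

/-- The discrete energy `E_N(μ)` as a function of the measure `μ ∈ 𝒜_N`. The infimum is over
the sorted particles of `μ`, which are unique (see `discreteEnergy_empirical`). -/
def discreteEnergy (H : ℝ → ℝ) (N : ℕ) (μ : Measure ℝ) : ℝ≥0∞ :=
  ⨅ x ∈ {x : Fin N → ℝ | StrictMono x ∧ μ = empirical x}, ENNReal.ofReal (particleEnergy H x)

theorem empirical_singleton_ne_zero {N : ℕ} (x : Fin N → ℝ) (a : ℝ) :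
    empirical x {a} ≠ 0 ↔ a ∈ range x := by
  have hN : (N : ℝ≥0∞)⁻¹ ≠ 0 := by simp
  simp [empirical, Set.indicator_apply, hN]

theorem empirical_injOn {N : ℕ} {x y : Fin N → ℝ} (hx : StrictMono x) (hy : StrictMono y)
    (h : empirical x = empirical y) : x = y := by
  refine (hx.range_inj hy).1 ?_
  ext a
  rw [← empirical_singleton_ne_zero, ← empirical_singleton_ne_zero, h]

/-- The discrete energy of an empirical measure is the energy of its sorted particles. -/
theorem discreteEnergy_empirical (H : ℝ → ℝ) {N : ℕ} {x : Fin N → ℝ} (hx : StrictMono x) :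
    discreteEnergy H N (empirical x) = ENNReal.ofReal (particleEnergy H x) := by
  refine le_antisymm (iInf₂_le x ⟨hx, rfl⟩) (le_iInf₂ fun y hy => ?_)
  rw [empirical_injOn hx hy.1 hy.2]

/-- `Γ`-convergence, with respect to the `p`-Wasserstein distance, of functionals `F N` on
`𝒜_N(Ω)`, `N ≥ 2`, to a functional `F'` on `𝒫_p(Ω)`. The values of a sequence at `N < 2` play
no role. -/
def GammaConverges (p : ℝ) (Ω : Set ℝ) (F : ℕ → Measure ℝ → ℝ≥0∞) (F' : Measure ℝ → ℝ≥0∞) :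
    Prop :=
  ∀ ρ ∈ ProbP p Ω,
    (∀ μ : ℕ → Measure ℝ, (∀ N, 2 ≤ N → μ N ∈ Atomic N Ω) →
      Tendsto (fun N => wassersteinDist p (μ N) ρ) atTop (𝓝 0) →
      F' ρ ≤ liminf (fun N => F N (μ N)) atTop) ∧
    (∃ μ : ℕ → Measure ℝ, (∀ N, 2 ≤ N → μ N ∈ Atomic N Ω) ∧
      Tendsto (fun N => wassersteinDist p (μ N) ρ) atTop (𝓝 0) ∧
      limsup (fun N => F N (μ N)) atTop ≤ F' ρ)

end ParticleGamma

end

namespace ParticleGamma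

/-! ### The energy density -/

/-! Lower bound. Inside an interval `I`, attach to each particle except the rightmost one the
stretch of length `minGap` on its right. These stretches are disjoint and stay in `I`, so Jensen's
inequality, with the unused weight placed at `0` where `H` vanishes, bounds the contribution of
these particles from below by `|I| H((μ_N(I) - 1/N)₊ / |I|)` (`le_sum_nonlastParticles`). The mass
of open intervals is lower semicontinuous under Wasserstein convergence, so the energies of the cell
averages of the limit are at most the liminf (`sum_le_liminf_discreteEnergy`). Superlinearity of `H`
turns this bound into absolute continuity (`CellEnergyBound.absolutelyContinuous`); Lebesgue
differentiation along shrinking grids and Fatou's lemma then recover the integral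
(`CellEnergyBound.lintegral_le`).

Recovery sequence. Replace `ρ` by a step density on finitely many cells of length `L`; by Jensen
this does not raise the energy, up to a small tail cell on the line (`hasFineGrid_Icc`,
`hasFineGrid_univ`). Place the particles at the quantiles `i / N` of the step density. Inside a cell
of mass `m` the spacing is `L / (N m)`, which produces `L H(m / L)` in the limit. The boundedly many
particles near cell boundaries still have gap at least `L / N`, and since `x H(1/x)` is
non-increasing each of them costs `O(1/N)` (`particleEnergy_quantileParticles_le`). A randomised
quantile coupling eventually matches almost every point with a particle of its own cell, so the
transport cost is governed by the cell size (`limsup_lintegral_coupledParticle_le`). Near-minimisers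
of distance plus energy excess replace a diagonal argument (`exists_recovery_sequence`). -/

theorem IsEnergyDensity.monotoneOn {H : ℝ → ℝ} (hH : IsEnergyDensity H) :
    MonotoneOn H (Ici 0) := by
  intro x hx y hy hxy
  rcases (mem_Ici.1 hy).eq_or_lt with h0 | h0
  · have : x = y := le_antisymm hxy (h0 ▸ hx)
    rw [this]
  have h := hH.convex.2 (mem_Ici.2 le_rfl) hy
    (sub_nonneg.2 ((div_le_one h0).2 hxy)) (div_nonneg hx h0.le) (by ring)
  simp only [smul_eq_mul, mul_zero, zero_add, hH.map_zero, div_mul_cancel₀ _ h0.ne'] at h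
  exact h.trans (mul_le_of_le_one_left (hH.nonneg y h0.le) ((div_le_one h0).2 hxy))

theorem IsEnergyDensity.continuous_max {H : ℝ → ℝ} (hH : IsEnergyDensity H) :
    Continuous fun x => H (max x 0) :=
  hH.continuous.comp_continuous (by fun_prop) fun x => le_max_right x 0

theorem IsEnergyDensity.tendsto {H : ℝ → ℝ} (hH : IsEnergyDensity H) {ι : Type*} {l : Filter ι}
    {u : ι → ℝ} {a : ℝ} (hu : ∀ i, 0 ≤ u i) (ha : 0 ≤ a) (h : Tendsto u l (𝓝 a)) :
    Tendsto (fun i => H (u i)) l (𝓝 (H a)) := by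
  have := (hH.continuous_max.tendsto a).comp h
  simpa [Function.comp_def, hu, ha] using this

/-- Jensen's inequality for subprobability weights. -/
theorem IsEnergyDensity.map_sum_le {H : ℝ → ℝ} (hH : IsEnergyDensity H) {ι : Type*}
    {s : Finset ι} {w q : ι → ℝ} (hw : ∀ i ∈ s, 0 ≤ w i) (hw1 : ∑ i ∈ s, w i ≤ 1)
    (hq : ∀ i ∈ s, 0 ≤ q i) : H (∑ i ∈ s, w i * q i) ≤ ∑ i ∈ s, w i * H (q i) := by
  have := hH.convex.map_add_sum_le (v := 1 - ∑ i ∈ s, w i) (q := 0) hw (by ring)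
    (fun i hi => mem_Ici.2 (hq i hi)) (by linarith) (mem_Ici.2 le_rfl)
  simpa [hH.map_zero] using this

/-! ### The gaps of a particle configuration -/

/-- The distance from the `i`-th particle to its nearest neighbour. -/
noncomputable def minGap {N : ℕ} (x : Fin N → ℝ) (i : Fin N) : ℝ :=
  ⨅ j : {j : Fin N // j ≠ i}, |x i - x j|

theorem minGap_le {N : ℕ} (x : Fin N → ℝ) {i j : Fin N} (h : j ≠ i) :
    minGap x i ≤ |x i - x j| :=
  ciInf_le (f := fun j : {j : Fin N // j ≠ i} => |x i - x j|) (finite_range _).bddBelow ⟨j, h⟩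

theorem minGap_nonneg {N : ℕ} (x : Fin N → ℝ) (i : Fin N) : 0 ≤ minGap x i :=
  Real.iInf_nonneg fun _ => abs_nonneg _

theorem nonempty_ne {N : ℕ} (hN : 2 ≤ N) (i : Fin N) : Nonempty {j : Fin N // j ≠ i} := by
  have : Nontrivial (Fin N) := Fin.nontrivial_iff_two_le.2 hN
  obtain ⟨j, hj⟩ := exists_ne i
  exact ⟨⟨j, hj⟩⟩

theorem le_minGap {N : ℕ} (hN : 2 ≤ N) {x : Fin N → ℝ} {i : Fin N} {g : ℝ}
    (h : ∀ j, j ≠ i → g ≤ |x i - x j|) : g ≤ minGap x i := by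
  have := nonempty_ne hN i
  exact le_ciInf fun j => h j.1 j.2

theorem minGap_pos {N : ℕ} (hN : 2 ≤ N) {x : Fin N → ℝ} (hx : Function.Injective x) (i : Fin N) :
    0 < minGap x i := by
  have := nonempty_ne hN i
  obtain ⟨j, hj⟩ := exists_eq_ciInf_of_finite (f := fun j : {j : Fin N // j ≠ i} => |x i - x j|)
  rw [minGap, ← hj]
  exact abs_pos.2 (sub_ne_zero.2 fun h => j.2 (hx h).symm)

theorem volume_real_particleBall {N : ℕ} (x : Fin N → ℝ) (i : Fin N) :
    volume.real (particleBall x i) = minGap x i := by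
  have : 0 ≤ minGap x i := minGap_nonneg x i
  rw [particleBall, Measure.real, Real.volume_ball, ← minGap, mul_div_cancel₀ _ two_ne_zero,
    ENNReal.toReal_ofReal this]

theorem particleEnergy_eq (H : ℝ → ℝ) {N : ℕ} (x : Fin N → ℝ) :
    particleEnergy H x = ∑ i, minGap x i * H (1 / (N * minGap x i)) := by
  simp only [particleEnergy, volume_real_particleBall]

theorem add_minGap_le {N : ℕ} {x : Fin N → ℝ} (hx : StrictMono x) {i j : Fin N} (h : i < j) :
    x i + minGap x i ≤ x j := by
  have h1 := minGap_le x h.ne'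
  rw [abs_sub_comm, abs_of_pos (sub_pos.2 (hx h))] at h1
  linarith

theorem empirical_apply {N : ℕ} (x : Fin N → ℝ) {s : Set ℝ} (hs : MeasurableSet s)
    [DecidablePred fun i => x i ∈ s] :
    (empirical x) s = (N : ℝ≥0∞)⁻¹ * ((Finset.univ.filter fun i => x i ∈ s).card : ℝ≥0∞) := by
  simp [empirical, hs, Set.indicator_apply, Finset.sum_boole]

theorem empirical_real {N : ℕ} (x : Fin N → ℝ) {s : Set ℝ} (hs : MeasurableSet s)
    [DecidablePred fun i => x i ∈ s] :
    (empirical x).real s = ((Finset.univ.filter fun i => x i ∈ s).card : ℝ) / N := by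
  rw [Measure.real, empirical_apply x hs]
  simp [div_eq_inv_mul]

/-! ### The lower bound for a single configuration -/

open scoped Classical in
/-- The particles of an interval that have another particle of the interval to their right. -/
noncomputable def nonlastParticles {N : ℕ} (x : Fin N → ℝ) (s : Set ℝ) : Finset (Fin N) :=
  Finset.univ.filter fun i => x i ∈ s ∧ ∃ j, i < j ∧ x j ∈ s

/-- Only the particle of largest index in `s` is discarded; this single particle is the source of
every `1 / N` in the lower bound. -/
theorem le_card_nonlastParticles {N : ℕ} (x : Fin N → ℝ) {s : Set ℝ} (hs : MeasurableSet s) :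
    (empirical x).real s - 1 / N ≤ (nonlastParticles x s).card / N := by
  classical
  rw [empirical_real x hs, ← sub_div]
  gcongr
  rw [sub_le_iff_le_add]
  have h1 : (Finset.univ.filter fun i => x i ∈ s) ⊆ nonlastParticles x s ∪
      (Finset.univ.filter fun i => x i ∈ s ∧ ∀ j, i < j → x j ∉ s) := by
    intro i hi
    simp only [nonlastParticles, Finset.mem_union, Finset.mem_filter, Finset.mem_univ, true_and]
      at hi ⊢
    by_cases h : ∃ j, i < j ∧ x j ∈ s
    · exact Or.inl ⟨hi, h⟩
    · push Not at h
      exact Or.inr ⟨hi, h⟩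
  have h2 : (Finset.univ.filter fun i => x i ∈ s ∧ ∀ j, i < j → x j ∉ s).card ≤ 1 := by
    rw [Finset.card_le_one]
    intro i hi j hj
    simp only [Finset.mem_filter, Finset.mem_univ, true_and] at hi hj
    rcases lt_trichotomy i j with h | h | h
    · exact absurd hj.1 (hi.2 j h)
    · exact h
    · exact absurd hi.1 (hj.2 i h)
  exact_mod_cast (Finset.card_le_card h1).trans
    ((Finset.card_union_le _ _).trans (Nat.add_le_add_left h2 _))

/-- The stretches `[x i, x i + minGap x i)` are pairwise disjoint, and each ends no later than the
next particle, which for these indices is still inside the interval. -/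
theorem sum_minGap_nonlastParticles_le {N : ℕ} {x : Fin N → ℝ} (hx : StrictMono x) {α β : ℝ}
    (hαβ : α < β) : ∑ i ∈ nonlastParticles x (Ioo α β), minGap x i ≤ β - α := by
  classical
  have hd : (nonlastParticles x (Ioo α β) : Set (Fin N)).PairwiseDisjoint
      fun i => Ico (x i) (x i + minGap x i) := by
    have key : ∀ i j : Fin N, i < j →
        Disjoint (Ico (x i) (x i + minGap x i)) (Ico (x j) (x j + minGap x j)) := by
      intro i j hij
      rw [Set.disjoint_left]
      intro y hy hy'
      exact absurd (hy.2.trans_le (add_minGap_le hx hij)) (not_lt.2 hy'.1)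
    intro i _ j _ hij
    rcases lt_or_gt_of_ne hij with h | h
    · exact key i j h
    · exact (key j i h).symm
  have hsub : (⋃ i ∈ nonlastParticles x (Ioo α β), Ico (x i) (x i + minGap x i)) ⊆ Ioo α β := by
    refine iUnion₂_subset fun i hi y hy => ?_
    simp only [nonlastParticles, Finset.mem_filter, Finset.mem_univ, true_and] at hi
    obtain ⟨hi, j, hij, hj⟩ := hi
    exact ⟨hi.1.trans_le hy.1, (hy.2.trans_le (add_minGap_le hx hij)).trans hj.2⟩
  have h := measure_mono (μ := volume) hsub
  rw [measure_biUnion_finset hd (fun _ _ => measurableSet_Ico), Real.volume_Ioo] at h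
  simp only [Real.volume_Ico, add_sub_cancel_left] at h
  rw [← ENNReal.ofReal_sum_of_nonneg fun i _ => minGap_nonneg x i] at h
  exact (ENNReal.ofReal_le_ofReal_iff (sub_nonneg.2 hαβ.le)).1 h

/-- Jensen with weights `minGap x i / (β - α)`, whose sum is at most one, at the points `1 / (N *
minGap x i)`. -/
theorem le_sum_nonlastParticles {H : ℝ → ℝ} (hH : IsEnergyDensity H) {N : ℕ} (hN : 2 ≤ N)
    {x : Fin N → ℝ} (hx : StrictMono x) {α β : ℝ} (hαβ : α < β) :
    (β - α) * H (max ((empirical x).real (Ioo α β) - 1 / N) 0 / (β - α)) ≤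
      ∑ i ∈ nonlastParticles x (Ioo α β), minGap x i * H (1 / (N * minGap x i)) := by
  have hl : 0 < β - α := sub_pos.2 hαβ
  have hN0 : (0 : ℝ) < N := by exact_mod_cast (by lia : 0 < N)
  have hd := fun i => minGap_pos hN hx.injective i
  have h1 := hH.map_sum_le (s := nonlastParticles x (Ioo α β))
    (w := fun i => minGap x i / (β - α)) (q := fun i => 1 / (N * minGap x i))
    (fun i _ => by have := hd i; positivity)
    (by rw [← Finset.sum_div, div_le_one hl]; exact sum_minGap_nonlastParticles_le hx hαβ)
    (fun i _ => by have := hd i; positivity)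
  -- The gaps cancel, so the barycentre in Jensen's inequality merely counts particles.
  have h2 : ∀ i, minGap x i / (β - α) * (1 / (N * minGap x i)) = 1 / N / (β - α) := by
    intro i
    have := (hd i).ne'
    field_simp
  simp only [h2, Finset.sum_const, nsmul_eq_mul] at h1
  have h3 : max ((empirical x).real (Ioo α β) - 1 / N) 0 / (β - α) ≤
      (nonlastParticles x (Ioo α β)).card * (1 / N / (β - α)) := by
    rw [← mul_div_assoc, mul_one_div]
    gcongr
    exact max_le (le_card_nonlastParticles x measurableSet_Ioo) (by positivity)
  calc _ ≤ (β - α) * ∑ i ∈ nonlastParticles x (Ioo α β),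
        minGap x i / (β - α) * H (1 / (N * minGap x i)) := by
        gcongr
        refine le_trans (hH.monotoneOn (mem_Ici.2 ?_) (mem_Ici.2 ?_) h3) h1 <;> positivity
    _ = _ := by
        rw [Finset.mul_sum]
        refine Finset.sum_congr rfl fun i _ => ?_
        field_simp

/-- The discrete energy dominates the energy of the cell averages over disjoint intervals. -/
theorem sum_le_particleEnergy {H : ℝ → ℝ} (hH : IsEnergyDensity H) {N : ℕ} (hN : 2 ≤ N)
    {x : Fin N → ℝ} (hx : StrictMono x) {ι : Type*} (T : Finset ι) {α β : ι → ℝ}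
    (hαβ : ∀ k ∈ T, α k < β k)
    (hdisj : (T : Set ι).PairwiseDisjoint fun k => Ioo (α k) (β k)) :
    ∑ k ∈ T, (β k - α k) *
      H (max ((empirical x).real (Ioo (α k) (β k)) - 1 / N) 0 / (β k - α k)) ≤
      particleEnergy H x := by
  classical
  rw [particleEnergy_eq]
  refine (Finset.sum_le_sum fun k hk => le_sum_nonlastParticles hH hN hx (hαβ k hk)).trans ?_
  rw [← Finset.sum_biUnion]
  · refine Finset.sum_le_sum_of_subset_of_nonneg (Finset.subset_univ _) fun i _ _ => ?_
    have := minGap_nonneg x i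
    exact mul_nonneg this (hH.nonneg _ (by positivity))
  · intro k hk l hl hkl
    rw [Function.onFun, Finset.disjoint_left]
    intro i hi hi'
    simp only [nonlastParticles, Finset.mem_filter, Finset.mem_univ, true_and] at hi hi'
    exact Set.disjoint_left.1 (hdisj hk hl hkl) hi.1 hi'.1

/-! ### Wasserstein convergence and open intervals -/

/-- Take a coupling of cost below `t`. Mass moved by less than `ε` out of the shrunken interval
stays in the full one, and Markov's inequality controls the mass moved farther. -/
theorem measure_Ioo_le_of_wassersteinDist_lt {p : ℝ} (hp : 1 < p) {μ ν : Measure ℝ} {t : ℝ≥0∞}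
    (ht : wassersteinDist p μ ν < t) {ε : ℝ} (hε : 0 < ε) (α β : ℝ) :
    ν (Ioo (α + ε) (β - ε)) ≤ μ (Ioo α β) + (t / ENNReal.ofReal ε) ^ p := by
  have hp0 : 0 < p := by linarith
  simp only [wassersteinDist, iInf_lt_iff] at ht
  obtain ⟨π, ⟨_, hπ1, hπ2⟩, hlt⟩ := ht
  have hlt' : ∫⁻ z, edist z.1 z.2 ^ p ∂π ≤ t ^ p := by
    have := ENNReal.rpow_le_rpow hlt.le hp0.le
    rwa [← ENNReal.rpow_mul, one_div, inv_mul_cancel₀ hp0.ne', ENNReal.rpow_one] at this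
  have hε0 : ENNReal.ofReal ε ≠ 0 := by simpa using hε
  have hεp0 : ENNReal.ofReal ε ^ p ≠ 0 := by simp [hε0, hp0]
  have hεpt : ENNReal.ofReal ε ^ p ≠ ∞ := ENNReal.rpow_ne_top_of_nonneg hp0.le ENNReal.ofReal_ne_top
  have hcheb : π {z | ENNReal.ofReal ε ≤ edist z.1 z.2} ≤ (t / ENNReal.ofReal ε) ^ p := by
    have hm : Measurable fun z : ℝ × ℝ => edist z.1 z.2 ^ p :=
      (measurable_fst.edist measurable_snd).pow_const p
    have := (mul_meas_ge_le_lintegral hm (μ := π) (ENNReal.ofReal ε ^ p)).trans hlt'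
    simp only [ENNReal.rpow_le_rpow_iff hp0] at this
    rw [ENNReal.div_rpow_of_nonneg _ _ hp0.le, ENNReal.le_div_iff_mul_le (Or.inl hεp0)
      (Or.inl hεpt), mul_comm]
    exact this
  rw [← hπ2, ← hπ1, Measure.map_apply measurable_snd measurableSet_Ioo,
    Measure.map_apply measurable_fst measurableSet_Ioo]
  refine le_trans ?_ (add_le_add_right hcheb _)
  refine le_trans (measure_mono ?_) (measure_union_le _ _)
  rintro ⟨y, z⟩ ⟨hz1, hz2⟩
  by_cases h : ENNReal.ofReal ε ≤ edist y z
  · exact Or.inr h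
  · left
    rw [edist_dist, not_le, ENNReal.ofReal_lt_ofReal_iff hε, Real.dist_eq, abs_lt] at h
    exact ⟨by linarith, by linarith⟩

theorem eventually_measure_Ioo_sub_lt {p : ℝ} (hp : 1 < p) {μ : ℕ → Measure ℝ} {ρ : Measure ℝ}
    [IsFiniteMeasure ρ] (hμ : ∀ᶠ N in atTop, IsFiniteMeasure (μ N))
    (h : Tendsto (fun N => wassersteinDist p (μ N) ρ) atTop (𝓝 0)) (α β : ℝ) {η : ℝ} (hη : 0 < η) :
    ∀ᶠ N in atTop, ρ.real (Ioo α β) - η ≤ (μ N).real (Ioo α β) - 1 / N := by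
  have hp0 : 0 < p := by linarith
  have hsh : Tendsto (fun n : ℕ => ρ.real (Ioo (α + 1 / (n + 1)) (β - 1 / (n + 1)))) atTop
      (𝓝 (ρ.real (Ioo α β))) := by
    refine (ENNReal.tendsto_toReal (measure_ne_top _ _)).comp ?_
    have hmono : Monotone fun n : ℕ => Ioo (α + 1 / ((n : ℝ) + 1)) (β - 1 / ((n : ℝ) + 1)) := by
      intro m n hmn
      have : (1 : ℝ) / (n + 1) ≤ 1 / (m + 1) := Nat.one_div_le_one_div hmn
      exact Ioo_subset_Ioo (by linarith) (by linarith)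
    have heq : Ioo α β = ⋃ n : ℕ, Ioo (α + 1 / ((n : ℝ) + 1)) (β - 1 / ((n : ℝ) + 1)) := by
      ext y
      simp only [mem_iUnion, mem_Ioo]
      constructor
      · rintro ⟨h1, h2⟩
        obtain ⟨n, hn⟩ := exists_nat_one_div_lt (lt_min (sub_pos.2 h1) (sub_pos.2 h2))
        rw [lt_min_iff] at hn
        exact ⟨n, by linarith, by linarith⟩
      · rintro ⟨n, h1, h2⟩
        have : (0 : ℝ) < 1 / (n + 1) := Nat.one_div_pos_of_nat
        exact ⟨by linarith, by linarith⟩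
    rw [heq]
    exact tendsto_measure_iUnion_atTop hmono
  obtain ⟨n, hn⟩ := (hsh.eventually_const_lt (sub_lt_self _ (by positivity : 0 < η / 3))).exists
  set ε : ℝ := 1 / (n + 1) with hεdef
  have hε : 0 < ε := Nat.one_div_pos_of_nat
  -- The budget `η` is split in three: shrinking the interval, the Markov term, and the `1 / N` of
  -- the discarded particle.
  obtain ⟨t, ht0, ht⟩ : ∃ t : ℝ, 0 < t ∧ (t / ε) ^ p = η / 3 := by
    refine ⟨(η / 3) ^ (1 / p) * ε, by positivity, ?_⟩
    rw [mul_div_cancel_right₀ _ hε.ne', ← Real.rpow_mul (by positivity), one_div,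
      inv_mul_cancel₀ hp0.ne', Real.rpow_one]
  have h1 : Tendsto (fun N : ℕ => (1 : ℝ) / N) atTop (𝓝 0) := tendsto_one_div_atTop_nhds_zero_nat
  filter_upwards [hμ, h.eventually_lt_const (ENNReal.ofReal_pos.2 ht0),
    h1.eventually_lt_const (by positivity : 0 < η / 3)] with N hfin hW hN
  have h2 := measure_Ioo_le_of_wassersteinDist_lt hp hW hε α β
  rw [← ENNReal.ofReal_div_of_pos hε, ENNReal.ofReal_rpow_of_pos (by positivity), ht] at h2
  have h3 := ENNReal.toReal_mono (by finiteness) h2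
  rw [ENNReal.toReal_add (by finiteness) (by finiteness),
    ENNReal.toReal_ofReal (by positivity)] at h3
  change ρ.real _ ≤ (μ N).real _ + _ at h3
  linarith

/-! ### The lower bound in the limit -/

/-- For fixed `η > 0` the finitely many cell masses of `μ N` eventually exceed those of `ρ` minus
`η`; monotonicity of `H` transfers this to the energies, and continuity lets `η` tend to zero. -/
theorem sum_le_liminf_discreteEnergy {p : ℝ} (hp : 1 < p) {H : ℝ → ℝ} (hH : IsEnergyDensity H)
    {Ω : Set ℝ} {μ : ℕ → Measure ℝ} (hμ : ∀ N, 2 ≤ N → μ N ∈ Atomic N Ω) {ρ : Measure ℝ}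
    [IsFiniteMeasure ρ] (h : Tendsto (fun N => wassersteinDist p (μ N) ρ) atTop (𝓝 0))
    {ι : Type*} (T : Finset ι) {α β : ι → ℝ} (hαβ : ∀ k ∈ T, α k < β k)
    (hdisj : (T : Set ι).PairwiseDisjoint fun k => Ioo (α k) (β k)) :
    ENNReal.ofReal (∑ k ∈ T, (β k - α k) * H (ρ.real (Ioo (α k) (β k)) / (β k - α k))) ≤
      liminf (fun N => discreteEnergy H N (μ N)) atTop := by
  have hfin : ∀ᶠ N in atTop, IsFiniteMeasure (μ N) := by
    filter_upwards [eventually_ge_atTop 2] with N hN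
    obtain ⟨x, -, -, hx⟩ := hμ N hN
    rw [hx]
    refine ⟨?_⟩
    classical
    rw [empirical_apply x MeasurableSet.univ]
    have : (N : ℝ≥0∞)⁻¹ ≠ ∞ := by simp; lia
    finiteness
  have key : ∀ η : ℝ, 0 < η → ENNReal.ofReal (∑ k ∈ T, (β k - α k) *
      H (max (ρ.real (Ioo (α k) (β k)) - η) 0 / (β k - α k))) ≤
      liminf (fun N => discreteEnergy H N (μ N)) atTop := by
    intro η hη
    refine le_liminf_of_le (by isBoundedDefault) ?_
    have hall : ∀ᶠ N in atTop, ∀ k ∈ T, ρ.real (Ioo (α k) (β k)) - η ≤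
        (μ N).real (Ioo (α k) (β k)) - 1 / N :=
      (eventually_all_finset T).2 fun k _ =>
        eventually_measure_Ioo_sub_lt hp hfin h (α k) (β k) hη
    filter_upwards [hall, eventually_ge_atTop 2] with N hN hN2
    obtain ⟨x, hx, -, hxN⟩ := hμ N hN2
    rw [hxN, discreteEnergy_empirical H hx]
    refine ENNReal.ofReal_le_ofReal
      (le_trans (Finset.sum_le_sum fun k hk => ?_) (sum_le_particleEnergy hH hN2 hx T hαβ hdisj))
    have hl : 0 < β k - α k := sub_pos.2 (hαβ k hk)
    refine mul_le_mul_of_nonneg_left (hH.monotoneOn (mem_Ici.2 (by positivity))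
      (mem_Ici.2 (by positivity)) ?_) hl.le
    have := hN k hk
    rw [hxN] at this
    gcongr
  have hlim : Tendsto (fun η : ℝ => ENNReal.ofReal (∑ k ∈ T, (β k - α k) *
      H (max (ρ.real (Ioo (α k) (β k)) - η) 0 / (β k - α k)))) (𝓝[>] 0)
      (𝓝 (ENNReal.ofReal (∑ k ∈ T, (β k - α k) *
        H (ρ.real (Ioo (α k) (β k)) / (β k - α k))))) := by
    refine (ENNReal.continuous_ofReal.tendsto _).comp (tendsto_finsetSum _ fun k hk => ?_)
    refine tendsto_nhdsWithin_of_tendsto_nhds (Tendsto.const_mul _ ?_)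
    have hl : 0 < β k - α k := sub_pos.2 (hαβ k hk)
    refine hH.tendsto (fun η => by positivity) (by positivity) ?_
    have : Continuous fun η : ℝ => max (ρ.real (Ioo (α k) (β k)) - η) 0 / (β k - α k) := by
      fun_prop
    simpa using this.tendsto 0
  exact le_of_tendsto hlim (eventually_mem_nhdsWithin.mono fun η hη => key η hη)

/-! ### From cell averages to absolute continuity and the integral energy -/

/-- The energies of the averages of `ρ` over disjoint intervals are bounded by `Λ`. -/
def CellEnergyBound (H : ℝ → ℝ) (ρ : Measure ℝ) (Λ : ℝ) : Prop :=
  ∀ (T : Finset ℤ) (α β : ℤ → ℝ), (∀ k ∈ T, α k < β k) →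
    ((T : Set ℤ).PairwiseDisjoint fun k => Ioo (α k) (β k)) →
    ∑ k ∈ T, (β k - α k) * H (ρ.real (Ioo (α k) (β k)) / (β k - α k)) ≤ Λ

/-- Quantitative superlinearity: beyond `M` one has `H y ≥ y / t`. This is the de la Vallée-Poussin
input for equi-integrability. -/
theorem IsEnergyDensity.exists_le_add {H : ℝ → ℝ} (hH : IsEnergyDensity H) {t : ℝ} (ht : 0 < t) :
    ∃ M : ℝ, 0 ≤ M ∧ ∀ y, 0 ≤ y → y ≤ M + t * H y := by
  obtain ⟨M, hM⟩ := (eventually_atTop.1 (hH.superlinear.eventually_ge_atTop (1 / t)))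
  refine ⟨max M 1, by positivity, fun y hy => ?_⟩
  have hHy := hH.nonneg y hy
  rcases le_total y (max M 1) with h | h
  · have : 0 ≤ t * H y := by positivity
    linarith
  · have hy0 : 0 < y := lt_of_lt_of_le (by positivity) h
    have h1 := hM y ((le_max_left _ _).trans h)
    rw [div_le_div_iff₀ ht hy0] at h1
    have : 0 ≤ max M 1 := by positivity
    linarith

theorem pairwiseDisjoint_grid {L : ℝ} (hL : 0 < L) (T : Set ℤ) :
    T.PairwiseDisjoint fun k : ℤ => Ioo (k * L) ((k + 1) * L) := by
  have key : ∀ k l : ℤ, k < l → Disjoint (Ioo (k * L) ((k + 1) * L)) (Ioo (l * L) ((l + 1) * L)) := by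
    intro k l hkl
    have : ((k : ℝ) + 1) * L ≤ l * L := by
      have : (k : ℝ) + 1 ≤ l := by exact_mod_cast hkl
      gcongr
    rw [Set.disjoint_left]
    intro y hy hy'
    exact absurd (hy.2.trans_le this) (not_lt.2 hy'.1.le)
  intro k _ l _ hkl
  rcases lt_or_gt_of_ne hkl with h | h
  · exact key k l h
  · exact (key l k h).symm

/-- Uniform integrability at the level of cells: short total length forces small mass, once `t` is
chosen small and then `M` is fixed. The growth bound is applied to the average of each cell. -/
theorem CellEnergyBound.sum_measure_le {H : ℝ → ℝ} {ρ : Measure ℝ} {Λ : ℝ}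
    (hρ : CellEnergyBound H ρ Λ) {t M : ℝ} (ht : 0 ≤ t)
    (hM : ∀ y, 0 ≤ y → y ≤ M + t * H y) (T : Finset ℤ) {α β : ℤ → ℝ}
    (hαβ : ∀ k ∈ T, α k < β k) (hd : (T : Set ℤ).PairwiseDisjoint fun k => Ioo (α k) (β k)) :
    ∑ k ∈ T, ρ.real (Ioo (α k) (β k)) ≤ M * (∑ k ∈ T, (β k - α k)) + t * Λ := by
  have h1 : ∀ k ∈ T, ρ.real (Ioo (α k) (β k)) ≤ M * (β k - α k) +
      t * ((β k - α k) * H (ρ.real (Ioo (α k) (β k)) / (β k - α k))) := by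
    intro k hk
    have hl : 0 < β k - α k := sub_pos.2 (hαβ k hk)
    have := hM (ρ.real (Ioo (α k) (β k)) / (β k - α k)) (by positivity)
    rw [div_le_iff₀ hl] at this
    linarith
  refine (Finset.sum_le_sum h1).trans ?_
  rw [Finset.sum_add_distrib, ← Finset.mul_sum, ← Finset.mul_sum]
  have := hρ T α β hαβ hd
  gcongr

/-- Shrink one interval around `a`, then let `t` tend to zero. Needed because open grid cells miss
the grid points. -/
theorem CellEnergyBound.measure_singleton {H : ℝ → ℝ} (hH : IsEnergyDensity H) {ρ : Measure ℝ}
    [IsFiniteMeasure ρ] {Λ : ℝ} (hρ : CellEnergyBound H ρ Λ) (a : ℝ) : ρ {a} = 0 := by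
  rw [← measureReal_eq_zero_iff]
  refine le_antisymm ?_ measureReal_nonneg
  have h1 : ∀ t : ℝ, 0 < t → ρ.real {a} ≤ t * Λ := by
    intro t ht
    obtain ⟨M, hM0, hM⟩ := hH.exists_le_add ht
    have h2 : ∀ ε : ℝ, 0 < ε → ρ.real {a} ≤ M * (2 * ε) + t * Λ := by
      intro ε hε
      have := hρ.sum_measure_le ht.le hM {0} (α := fun _ => a - ε) (β := fun _ => a + ε)
        (fun _ _ => by linarith) (by simp)
      simp only [Finset.sum_singleton] at this
      have h3 : ρ.real {a} ≤ ρ.real (Ioo (a - ε) (a + ε)) :=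
        measureReal_mono (by simp [hε])
      calc _ ≤ _ := h3
        _ ≤ _ := this
        _ = _ := by ring
    have hc : Continuous fun ε : ℝ => M * (2 * ε) + t * Λ := by fun_prop
    have := ge_of_tendsto (tendsto_nhdsWithin_of_tendsto_nhds (s := Ioi 0) (hc.tendsto 0))
      (eventually_mem_nhdsWithin.mono fun ε hε => h2 ε hε)
    simpa using this
  have hc : Continuous fun t : ℝ => t * Λ := by fun_prop
  have := ge_of_tendsto (tendsto_nhdsWithin_of_tendsto_nhds (s := Ioi 0) (hc.tendsto 0))
    (eventually_mem_nhdsWithin.mono fun ε hε => h1 ε hε)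
  simpa using this

/-- Up to the null set of grid points, `K` is covered by the finitely many cells of mesh `L` that
touch it, and these lie within distance `L` of `K`. -/
theorem CellEnergyBound.measure_compact_le {H : ℝ → ℝ} (hH : IsEnergyDensity H) {ρ : Measure ℝ}
    [IsFiniteMeasure ρ] {Λ : ℝ} (hρ : CellEnergyBound H ρ Λ) {t M : ℝ} (ht : 0 ≤ t) (hM0 : 0 ≤ M)
    (hM : ∀ y, 0 ≤ y → y ≤ M + t * H y) {K : Set ℝ} (hK : IsCompact K) {L : ℝ} (hL : 0 < L) :
    ρ.real K ≤ M * volume.real (Metric.cthickening L K) + t * Λ := by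
  classical
  have hfin : {k : ℤ | (Icc (k * L) ((k + 1) * L) ∩ K).Nonempty}.Finite := by
    obtain ⟨R, hR⟩ := hK.isBounded.subset_closedBall 0
    refine (finite_Icc (-⌈R / L⌉ - 1) ⌈R / L⌉).subset ?_
    rintro k ⟨y, hy, hyK⟩
    have h1 := hR hyK
    rw [mem_closedBall_zero_iff, Real.norm_eq_abs, abs_le] at h1
    have h2 : R ≤ ⌈R / L⌉ * L := (div_le_iff₀ hL).1 (Int.le_ceil _)
    constructor
    · have : -((⌈R / L⌉ : ℤ) : ℝ) * L ≤ ((k : ℝ) + 1) * L := by linarith [hy.2]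
      have := le_of_mul_le_mul_right this hL
      have : -⌈R / L⌉ ≤ k + 1 := by exact_mod_cast this
      lia
    · have : (k : ℝ) * L ≤ (⌈R / L⌉ : ℤ) * L := by linarith [hy.1]
      exact_mod_cast le_of_mul_le_mul_right this hL
  set T := hfin.toFinset with hT
  have hd := pairwiseDisjoint_grid hL (T : Set ℤ)
  have hlt : ∀ k ∈ T, (k : ℝ) * L < ((k : ℝ) + 1) * L := fun k _ => by linarith
  have hlen : ∑ k ∈ T, (((k : ℝ) + 1) * L - k * L) ≤ volume.real (Metric.cthickening L K) := by
    have h1 : volume.real (⋃ k ∈ T, Ioo ((k : ℝ) * L) (((k : ℝ) + 1) * L)) =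
        ∑ k ∈ T, (((k : ℝ) + 1) * L - k * L) := by
      rw [measureReal_biUnion_finset hd (fun _ _ => measurableSet_Ioo)
        (fun _ _ => measure_Ioo_lt_top.ne)]
      exact Finset.sum_congr rfl fun k hk => Real.volume_real_Ioo_of_le (hlt k hk).le
    rw [← h1]
    refine measureReal_mono (iUnion₂_subset fun k hk y hy => ?_)
      hK.cthickening.measure_lt_top.ne
    obtain ⟨z, hz, hzK⟩ := hfin.mem_toFinset.1 hk
    refine Metric.mem_cthickening_of_dist_le y z L K hzK ?_
    rw [Real.dist_eq, abs_le]
    constructor <;> linarith [hy.1, hy.2, hz.1, hz.2]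
  have hcov : K ⊆ (⋃ k ∈ T, Ioo ((k : ℝ) * L) (((k : ℝ) + 1) * L)) ∪
      range (fun k : ℤ => (k : ℝ) * L) := by
    intro y hy
    have h1 : (⌊y / L⌋ : ℝ) * L ≤ y := (le_div_iff₀ hL).1 (Int.floor_le _)
    have h2 : y < ((⌊y / L⌋ : ℝ) + 1) * L := (div_lt_iff₀ hL).1 (Int.lt_floor_add_one _)
    rcases h1.eq_or_lt with h | h
    · exact Or.inr ⟨_, h⟩
    · exact Or.inl (mem_iUnion₂.2 ⟨⌊y / L⌋, hfin.mem_toFinset.2 ⟨y, ⟨h1, h2.le⟩, hy⟩, h, h2⟩)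
  have hnull : ρ.real (range (fun k : ℤ => (k : ℝ) * L)) = 0 := by
    rw [measureReal_eq_zero_iff, ← biUnion_of_singleton (range _)]
    exact (measure_biUnion_null_iff (countable_range _)).2 fun a _ => hρ.measure_singleton hH a
  calc ρ.real K ≤ _ := measureReal_mono hcov
    _ ≤ _ := measureReal_union_le _ _
    _ = ∑ k ∈ T, ρ.real (Ioo ((k : ℝ) * L) (((k : ℝ) + 1) * L)) := by
      rw [hnull, add_zero, measureReal_biUnion_finset hd (fun _ _ => measurableSet_Ioo)]
    _ ≤ M * (∑ k ∈ T, (((k : ℝ) + 1) * L - k * L)) + t * Λ :=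
      hρ.sum_measure_le ht hM T hlt hd
    _ ≤ _ := by gcongr

/-- For a Lebesgue-null compact set the thickenings have vanishing volume, so first `L` and then `t`
can be sent to zero; inner regularity covers all measurable null sets. -/
theorem CellEnergyBound.absolutelyContinuous {H : ℝ → ℝ} (hH : IsEnergyDensity H) {ρ : Measure ℝ}
    [IsFiniteMeasure ρ] {Λ : ℝ} (hρ : CellEnergyBound H ρ Λ) : ρ ≪ volume := by
  have hcomp : ∀ K : Set ℝ, IsCompact K → volume K = 0 → ρ K = 0 := by
    intro K hK hK0
    rw [← measureReal_eq_zero_iff]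
    refine le_antisymm ?_ measureReal_nonneg
    have h1 : ∀ t : ℝ, 0 < t → ρ.real K ≤ t * Λ := by
      intro t ht
      obtain ⟨M, hM0, hM⟩ := hH.exists_le_add ht
      have hv : Tendsto (fun L => volume.real (Metric.cthickening L K)) (𝓝 0) (𝓝 0) := by
        have := tendsto_measure_cthickening_of_isCompact (μ := volume) hK
        rw [hK0] at this
        exact (ENNReal.tendsto_toReal ENNReal.zero_ne_top).comp this
      have := ge_of_tendsto (tendsto_nhdsWithin_of_tendsto_nhds (s := Ioi 0)
        ((hv.const_mul M).add_const (t * Λ)))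
        (eventually_mem_nhdsWithin.mono fun L hL => hρ.measure_compact_le hH ht.le hM0 hM hK hL)
      simpa using this
    have hc : Continuous fun t : ℝ => t * Λ := by fun_prop
    have := ge_of_tendsto (tendsto_nhdsWithin_of_tendsto_nhds (s := Ioi 0) (hc.tendsto 0))
      (eventually_mem_nhdsWithin.mono fun ε hε => h1 ε hε)
    simpa using this
  refine Measure.AbsolutelyContinuous.mk fun s hs hs0 => ?_
  rw [hs.measure_eq_iSup_isCompact]
  simp only [ENNReal.iSup_eq_zero]
  exact fun K hKs hK => hcomp K hK (measure_mono_null hKs hs0)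

/-- The averages over the cells of a vanishing grid converge to the density. -/
theorem ae_tendsto_grid_average {ρ : Measure ℝ} [IsFiniteMeasure ρ] (hac : ρ ≪ volume) {L : ℕ → ℝ}
    (hL : ∀ n, 0 < L n) (hL0 : Tendsto L atTop (𝓝 0)) :
    ∀ᵐ x, Tendsto (fun n => ρ.real (Ioo (⌊x / L n⌋ * L n) ((⌊x / L n⌋ + 1) * L n)) / L n) atTop
      (𝓝 (ρ.rnDeriv volume x).toReal) := by
  have hint : Integrable (fun x => (ρ.rnDeriv volume x).toReal) := Measure.integrable_toReal_rnDeriv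
  filter_upwards [IsUnifLocDoublingMeasure.ae_tendsto_average volume hint.locallyIntegrable 1]
    with x hx
  -- The cell is seen as a closed ball about its midpoint. It is not centred at `x` but contains it,
  -- which is the form of differentiation available for doubling measures.
  have hx := hx (l := atTop) (fun n => ((⌊x / L n⌋ : ℝ) + 1 / 2) * L n) (fun n => L n / 2) ?_ ?_
  · refine hx.congr fun n => ?_
    have hLn := hL n
    have hball : Metric.closedBall (((⌊x / L n⌋ : ℝ) + 1 / 2) * L n) (L n / 2) =
        Icc (⌊x / L n⌋ * L n) ((⌊x / L n⌋ + 1) * L n) := by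
      rw [Real.closedBall_eq_Icc]
      congr 1 <;> ring
    rw [hball, setAverage_eq, Measure.setIntegral_toReal_rnDeriv hac,
      Real.volume_real_Icc_of_le (by linarith), smul_eq_mul, ← div_eq_inv_mul]
    congr 1
    · exact (measureReal_congr (hac.ae_le Ioo_ae_eq_Icc)).symm
    · ring
  · refine tendsto_nhdsWithin_iff.2 ⟨by simpa using hL0.div_const 2, Eventually.of_forall fun n => ?_⟩
    have := hL n
    exact mem_Ioi.2 (by positivity)
  · refine Eventually.of_forall fun n => ?_
    have hLn := hL n
    have h1 : (⌊x / L n⌋ : ℝ) * L n ≤ x := (le_div_iff₀ hLn).1 (Int.floor_le _)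
    have h2 : x < ((⌊x / L n⌋ : ℝ) + 1) * L n := (div_lt_iff₀ hLn).1 (Int.lt_floor_add_one _)
    rw [Real.closedBall_eq_Icc]
    constructor <;> linarith

/-- Apply Fatou's lemma to the step functions carrying the energies of the cell averages: they
converge almost everywhere to the energy of the density, with integrals bounded by `Λ`. -/
theorem CellEnergyBound.lintegral_le {H : ℝ → ℝ} (hH : IsEnergyDensity H) {ρ : Measure ℝ}
    [IsFiniteMeasure ρ] {Λ : ℝ} (hρ : CellEnergyBound H ρ Λ) :
    ∫⁻ x, ENNReal.ofReal (H (ρ.rnDeriv volume x).toReal) ≤ ENNReal.ofReal Λ := by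
  have hac := hρ.absolutelyContinuous hH
  set L : ℕ → ℝ := fun n => 1 / ((n : ℝ) + 1) with hLdef
  have hL : ∀ n, 0 < L n := fun n => Nat.one_div_pos_of_nat
  have hL0 : Tendsto L atTop (𝓝 0) := tendsto_one_div_add_atTop_nhds_zero_nat
  -- With mesh `1 / (n + 1)` these indices reach out to distance about `n + 1`, so the finite grids
  -- exhaust the line while the mesh vanishes.
  set T : ℕ → Finset ℤ := fun n => Finset.Icc (-((n : ℤ) + 1) ^ 2) (((n : ℤ) + 1) ^ 2)
  set v : ℕ → ℤ → ℝ := fun n k => H (ρ.real (Ioo (k * L n) ((k + 1) * L n)) / L n) with hv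
  have hv0 : ∀ n k, 0 ≤ v n k := fun n k =>
    hH.nonneg _ (div_nonneg measureReal_nonneg (hL n).le)
  set g : ℕ → ℝ → ℝ≥0∞ := fun n x => ∑ k ∈ T n,
    (Ico (k * L n) ((k + 1) * L n)).indicator (fun _ => ENNReal.ofReal (v n k)) x with hg
  have hgm : ∀ n, Measurable (g n) := fun n => Finset.measurable_fun_sum _ fun k _ =>
    measurable_const.indicator measurableSet_Ico
  have hgint : ∀ n, ∫⁻ x, g n x ≤ ENNReal.ofReal Λ := by
    intro n
    rw [lintegral_finsetSum _ fun k _ => measurable_const.indicator measurableSet_Ico]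
    have h1 := hρ (T n) (fun k => k * L n) (fun k => (k + 1) * L n)
      (fun k _ => by linarith [hL n]) (pairwiseDisjoint_grid (hL n) _)
    refine le_trans (le_of_eq ?_) (ENNReal.ofReal_le_ofReal h1)
    have h2 : ∀ k : ℤ, ((k : ℝ) + 1) * L n - k * L n = L n := fun k => by ring
    simp only [h2]
    rw [ENNReal.ofReal_sum_of_nonneg fun k _ => mul_nonneg (hL n).le (hv0 n k)]
    refine Finset.sum_congr rfl fun k _ => ?_
    rw [lintegral_indicator_const measurableSet_Ico, Real.volume_Ico, h2,
      ENNReal.ofReal_mul (hL n).le, mul_comm]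
  have hgx : ∀ n x, ⌊x / L n⌋ ∈ T n → g n x = ENNReal.ofReal (v n ⌊x / L n⌋) := by
    intro n x hx
    have hmem : ∀ k : ℤ, x ∈ Ico (k * L n) ((k + 1) * L n) ↔ k = ⌊x / L n⌋ := by
      intro k
      rw [eq_comm, Int.floor_eq_iff, le_div_iff₀ (hL n), div_lt_iff₀ (hL n), mem_Ico]
    simp only [hg, Set.indicator_apply, hmem, Finset.sum_ite_eq', hx, if_true]
  have hT : ∀ x : ℝ, ∀ᶠ n in atTop, ⌊x / L n⌋ ∈ T n := by
    intro x
    filter_upwards [eventually_ge_atTop ⌈|x|⌉₊] with n hn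
    have hn' : |x| ≤ n := (Nat.le_ceil _).trans (by exact_mod_cast hn)
    obtain ⟨h1, h2⟩ := abs_le.1 hn'
    have hx : x / L n = x * (n + 1) := by simp [hLdef]
    have hn0 : (0 : ℝ) ≤ n := n.cast_nonneg
    rw [hx, Finset.mem_Icc]
    constructor
    · rw [Int.le_floor]
      push_cast
      nlinarith
    · have : ((⌊x * (n + 1)⌋ : ℤ) : ℝ) ≤ ((n : ℝ) + 1) ^ 2 := by
        refine (Int.floor_le _).trans ?_
        nlinarith
      exact_mod_cast this
  have hlim : ∀ᵐ x, ENNReal.ofReal (H (ρ.rnDeriv volume x).toReal) =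
      liminf (fun n => g n x) atTop := by
    filter_upwards [ae_tendsto_grid_average hac hL hL0] with x hx
    refine (Tendsto.liminf_eq ?_).symm
    have h1 := (ENNReal.continuous_ofReal.tendsto _).comp
      (hH.tendsto (fun n => div_nonneg measureReal_nonneg (hL n).le) ENNReal.toReal_nonneg hx)
    refine h1.congr' ?_
    filter_upwards [hT x] with n hn
    rw [hgx n x hn]
    rfl
  rw [lintegral_congr_ae hlim]
  refine (lintegral_liminf_le hgm).trans ?_
  exact (liminf_le_liminf (Eventually.of_forall hgint)).trans (by simp)

theorem energy_le_liminf {p : ℝ} (hp : 1 < p) {H : ℝ → ℝ} (hH : IsEnergyDensity H)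
    {Ω : Set ℝ} {μ : ℕ → Measure ℝ} (hμ : ∀ N, 2 ≤ N → μ N ∈ Atomic N Ω) {ρ : Measure ℝ}
    [IsFiniteMeasure ρ] (h : Tendsto (fun N => wassersteinDist p (μ N) ρ) atTop (𝓝 0)) :
    energy H Ω ρ ≤ liminf (fun N => discreteEnergy H N (μ N)) atTop := by
  set Λ := liminf (fun N => discreteEnergy H N (μ N)) atTop with hΛ
  rcases eq_or_ne Λ ∞ with htop | htop
  · simp [htop]
  have hρ : CellEnergyBound H ρ Λ.toReal := by
    intro T α β hαβ hd
    exact (ENNReal.ofReal_le_iff_le_toReal htop).1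
      (sum_le_liminf_discreteEnergy hp hH hμ h T hαβ hd)
  rw [energy, if_pos (hρ.absolutelyContinuous hH)]
  refine (setLIntegral_le_lintegral _ _).trans ((hρ.lintegral_le hH).trans ?_)
  rw [ENNReal.ofReal_toReal htop]

/-! ### Quantiles of step densities -/

/-- The partial sums of the cell masses. -/
def cumMass (m : ℕ → ℝ) (k : ℕ) : ℝ := ∑ j ∈ Finset.range k, m j

theorem cumMass_zero (m : ℕ → ℝ) : cumMass m 0 = 0 := by simp [cumMass]

theorem cumMass_succ (m : ℕ → ℝ) (k : ℕ) : cumMass m (k + 1) = cumMass m k + m k :=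
  Finset.sum_range_succ _ _

theorem cumMass_mono {m : ℕ → ℝ} (hm : ∀ k, 0 ≤ m k) : Monotone (cumMass m) :=
  monotone_nat_of_le_succ fun k => by rw [cumMass_succ]; linarith [hm k]

/-- The index of the cell that contains the quantile of level `s`. -/
noncomputable def cellIdx (m : ℕ → ℝ) (s : ℝ) : ℕ := sInf {k | s < cumMass m (k + 1)}

theorem cellIdx_eq {m : ℕ → ℝ} (hm : ∀ k, 0 ≤ m k) {s : ℝ} {k : ℕ} (h1 : cumMass m k ≤ s)
    (h2 : s < cumMass m (k + 1)) : cellIdx m s = k := by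
  refine le_antisymm (Nat.sInf_le h2) (le_csInf ⟨k, h2⟩ fun j hj => ?_)
  by_contra! hlt
  exact absurd (hj.trans_le (cumMass_mono hm (Nat.succ_le_of_lt hlt))) (not_lt.2 h1)

theorem cellIdx_spec {m : ℕ → ℝ} {n : ℕ} {s : ℝ} (h0 : 0 ≤ s) (h1 : s < cumMass m n) :
    cellIdx m s < n ∧ cumMass m (cellIdx m s) ≤ s ∧ s < cumMass m (cellIdx m s + 1) := by
  cases n with
  | zero => rw [cumMass_zero] at h1; linarith
  | succ n =>
    have hne : {k | s < cumMass m (k + 1)}.Nonempty := ⟨n, h1⟩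
    refine ⟨Nat.lt_succ_of_le (Nat.sInf_le h1), ?_, Nat.sInf_mem hne⟩
    rcases h : cellIdx m s with _ | j
    · rwa [cumMass_zero]
    · by_contra! hlt
      have : cellIdx m s ≤ j := Nat.sInf_le hlt
      lia

/-- The quantile function of the density with mass `m k` on `[c + L k, c + L (k + 1))`. -/
noncomputable def stepQuantile (c L : ℝ) (m : ℕ → ℝ) (s : ℝ) : ℝ :=
  c + L * (cellIdx m s + (s - cumMass m (cellIdx m s)) / m (cellIdx m s))

section StepQuantile

variable {c L : ℝ} {m : ℕ → ℝ}

theorem stepQuantile_eq (hm : ∀ k, 0 ≤ m k) {s : ℝ} {k : ℕ} (h1 : cumMass m k ≤ s)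
    (h2 : s < cumMass m (k + 1)) :
    stepQuantile c L m s = c + L * (k + (s - cumMass m k) / m k) := by
  rw [stepQuantile, cellIdx_eq hm h1 h2]

theorem stepQuantile_mem_cell (hL : 0 < L) (hm : ∀ k, 0 ≤ m k) {s : ℝ} {k : ℕ}
    (h1 : cumMass m k ≤ s) (h2 : s < cumMass m (k + 1)) :
    stepQuantile c L m s ∈ Icc (c + L * k) (c + L * (k + 1)) := by
  rw [stepQuantile_eq hm h1 h2]
  rw [cumMass_succ] at h2
  have h3 : 0 ≤ (s - cumMass m k) / m k := div_nonneg (by linarith) (hm k)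
  have h4 : (s - cumMass m k) / m k ≤ 1 := div_le_one_of_le₀ (by linarith) (hm k)
  constructor <;> gcongr
  linarith

theorem stepQuantile_mem_Icc (hL : 0 < L) (hm : ∀ k, 0 ≤ m k) {n : ℕ} {s : ℝ} (h0 : 0 ≤ s)
    (h1 : s < cumMass m n) : stepQuantile c L m s ∈ Icc c (c + L * n) := by
  obtain ⟨h2, h3, h4⟩ := cellIdx_spec h0 h1
  have h5 := stepQuantile_mem_cell (c := c) hL hm h3 h4
  have h6 : ((cellIdx m s : ℕ) : ℝ) + 1 ≤ n := by exact_mod_cast h2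
  refine ⟨le_trans ?_ h5.1, h5.2.trans ?_⟩
  · have : (0 : ℝ) ≤ L * cellIdx m s := by positivity
    linarith
  · gcongr

/-- The slope of the quantile function on a cell is `L / m k ≥ L`, and jumps over empty cells only
increase distances. -/
theorem stepQuantile_sub_ge (hL : 0 < L) (hm : ∀ k, 0 ≤ m k) (hm1 : ∀ k, m k ≤ 1) {n : ℕ}
    {s t : ℝ} (h0 : 0 ≤ s) (hst : s ≤ t) (h1 : t < cumMass m n) :
    L * (t - s) ≤ stepQuantile c L m t - stepQuantile c L m s := by
  obtain ⟨-, hk1, hk2⟩ := cellIdx_spec h0 (hst.trans_lt h1)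
  obtain ⟨-, hl1, hl2⟩ := cellIdx_spec (h0.trans hst) h1
  rw [stepQuantile_eq hm hk1 hk2, stepQuantile_eq hm hl1 hl2]
  set k := cellIdx m s
  set l := cellIdx m t
  have e1 := cumMass_succ m k
  have e2 := cumMass_succ m l
  have pk : 0 < m k := by linarith
  have pl : 0 < m l := by linarith
  suffices h : t - s ≤ (l + (t - cumMass m l) / m l) - (k + (s - cumMass m k) / m k) by
    nlinarith
  rcases lt_trichotomy k l with h | h | h
  -- For different cells, `t - s` splits into the rest of cell `k`, the full cells in between, and
  -- the start of cell `l`; this monotonicity handles the full cells.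
  · have hmono : Monotone fun k : ℕ => (k : ℝ) - cumMass m k :=
      monotone_nat_of_le_succ fun k => by rw [cumMass_succ]; push_cast; linarith [hm1 k]
    have h3 := hmono (Nat.succ_le_of_lt h)
    simp only [Nat.succ_eq_add_one, Nat.cast_add, Nat.cast_one] at h3
    have h4 : t - cumMass m l ≤ (t - cumMass m l) / m l :=
      le_div_self (by linarith) pl (hm1 l)
    have h5 : cumMass m (k + 1) - s ≤ (cumMass m (k + 1) - s) / m k :=
      le_div_self (by linarith) pk (hm1 k)
    have h6 : (cumMass m (k + 1) - s) / m k = 1 - (s - cumMass m k) / m k := by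
      rw [e1]; field_simp; ring
    linarith
  · rw [← h]
    have h4 : t - s ≤ (t - s) / m k := le_div_self (by linarith) pk (hm1 k)
    have h5 : (t - s) / m k = (t - cumMass m k) / m k - (s - cumMass m k) / m k := by ring
    linarith
  · have := cumMass_mono hm (Nat.succ_le_of_lt h)
    simp only [Nat.succ_eq_add_one] at this
    linarith

/-! ### The energy of quantile configurations -/

/-- The `N` particles at the quantiles `i / N` of a step density. -/
noncomputable def quantileParticles (c L : ℝ) (m : ℕ → ℝ) (N : ℕ) (i : Fin N) : ℝ :=
  stepQuantile c L m (i / N)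

theorem Fin.cast_div_lt_one {N : ℕ} (i : Fin N) : (i : ℝ) / N < 1 := by
  have : 0 < N := i.pos
  rw [div_lt_one (by exact_mod_cast this)]
  exact_mod_cast i.2

theorem quantileParticles_sub_ge (hL : 0 < L) (hm : ∀ k, 0 ≤ m k) (hm1 : ∀ k, m k ≤ 1) {n : ℕ}
    (hn : cumMass m n = 1) {N : ℕ} {i j : Fin N} (hij : i ≤ j) :
    L * ((j - i) / N) ≤ quantileParticles c L m N j - quantileParticles c L m N i := by
  rw [sub_div]
  refine stepQuantile_sub_ge hL hm hm1 (by positivity) ?_ (hn ▸ Fin.cast_div_lt_one j)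
  have : (i : ℝ) ≤ j := by exact_mod_cast hij
  gcongr

theorem quantileParticles_strictMono (hL : 0 < L) (hm : ∀ k, 0 ≤ m k) (hm1 : ∀ k, m k ≤ 1) {n : ℕ}
    (hn : cumMass m n = 1) (N : ℕ) : StrictMono (quantileParticles c L m N) := by
  intro i j hij
  have h := quantileParticles_sub_ge (c := c) hL hm hm1 hn hij.le
  have hN : (0 : ℝ) < N := by exact_mod_cast i.pos
  have h1 : (0 : ℝ) < (j : ℝ) - i := sub_pos.2 (by exact_mod_cast hij)
  have : 0 < L * (((j : ℝ) - i) / N) := by positivity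
  linarith

/-- A crude bound valid for every particle, used for those next to a cell boundary. -/
theorem le_mul_minGap_quantileParticles (hL : 0 < L) (hm : ∀ k, 0 ≤ m k) (hm1 : ∀ k, m k ≤ 1)
    {n : ℕ} (hn : cumMass m n = 1) {N : ℕ} (hN : 2 ≤ N) (i : Fin N) :
    L ≤ N * minGap (quantileParticles c L m N) i := by
  have hN0 : (0 : ℝ) < N := by exact_mod_cast i.pos
  rw [← div_le_iff₀' hN0]
  have key : ∀ i j : Fin N, i < j →
      L / N ≤ |quantileParticles c L m N i - quantileParticles c L m N j| := by
    intro i j hij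
    have h := quantileParticles_sub_ge (c := c) hL hm hm1 hn hij.le
    have h1 : (1 : ℝ) ≤ (j : ℝ) - i := by
      have : (i : ℝ) + 1 ≤ j := by exact_mod_cast hij
      linarith
    rw [abs_sub_comm]
    refine le_trans (le_trans ?_ h) (le_abs_self _)
    rw [← mul_div_assoc]
    gcongr
    exact le_mul_of_one_le_right hL.le h1
  refine le_minGap hN fun j hj => ?_
  rcases lt_or_gt_of_ne hj with h | h
  · rw [abs_sub_comm]; exact key j i h
  · exact key i j h

/-- When the levels of a particle and of its two neighbours fall in the same cell, the affine
formula for the quantile gives the sharp spacing. -/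
theorem le_mul_minGap_of_interior (hL : 0 < L) (hm : ∀ k, 0 ≤ m k) (hm1 : ∀ k, m k ≤ 1)
    {n : ℕ} (hn : cumMass m n = 1) {N : ℕ} (hN : 2 ≤ N) {i : Fin N} {k : ℕ}
    (h1 : cumMass m k ≤ ((i : ℝ) - 1) / N) (h2 : ((i : ℝ) + 1) / N < cumMass m (k + 1)) :
    L / m k ≤ N * minGap (quantileParticles c L m N) i := by
  have hN0 : (0 : ℝ) < N := by exact_mod_cast i.pos
  rw [← div_le_iff₀' hN0]
  have hmon := (quantileParticles_strictMono (c := c) hL hm hm1 hn N).monotone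
  -- One-sided estimate, used with `j = i` for the right neighbours and with `j = i - 1` for the
  -- left ones.
  have key : ∀ j : Fin N, cumMass m k ≤ (j : ℝ) / N → ((j : ℝ) + 1) / N < cumMass m (k + 1) →
      ∀ l, j < l → L / m k / N ≤ quantileParticles c L m N l - quantileParticles c L m N j := by
    intro j hj1 hj2 l hjl
    have hlt : (j : ℕ) + 1 < N := lt_of_le_of_lt (Nat.succ_le_of_lt hjl) l.2
    have h3 : quantileParticles c L m N ⟨j + 1, hlt⟩ ≤ quantileParticles c L m N l :=
      hmon (Fin.mk_le_of_le_val (Nat.succ_le_of_lt hjl))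
    have hle : (j : ℝ) / N ≤ ((j : ℝ) + 1) / N := by gcongr; linarith
    have h4 : quantileParticles c L m N ⟨j + 1, hlt⟩ - quantileParticles c L m N j =
        L / m k / N := by
      simp only [quantileParticles, Nat.cast_add, Nat.cast_one]
      rw [stepQuantile_eq hm hj1 (hle.trans_lt hj2), stepQuantile_eq hm (hj1.trans hle) hj2]
      ring
    linarith
  have hle1 : ((i : ℝ) - 1) / N ≤ (i : ℝ) / N := by gcongr; linarith
  have hle2 : (i : ℝ) / N ≤ ((i : ℝ) + 1) / N := by gcongr; linarith
  refine le_minGap hN fun j hj => ?_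
  rcases lt_or_gt_of_ne hj with h | h
  · have hi0 : 0 < (i : ℕ) := lt_of_le_of_lt (Nat.zero_le _) h
    have hcast : (((i : ℕ) - 1 : ℕ) : ℝ) = (i : ℝ) - 1 := by
      rw [Nat.cast_sub hi0]; simp
    have h3 := key ⟨(i : ℕ) - 1, by lia⟩ (by simpa only [hcast] using h1)
      (by simp only [hcast, sub_add_cancel]; exact hle2.trans_lt h2) i
      (Fin.mk_lt_of_lt_val (by lia))
    have h4 : quantileParticles c L m N j ≤ quantileParticles c L m N ⟨(i : ℕ) - 1, by lia⟩ :=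
      hmon (Fin.le_def.2 (Nat.le_sub_one_of_lt h))
    exact le_trans (by linarith) (le_abs_self _)
  · rw [abs_sub_comm]
    exact (key i (h1.trans hle1) h2 j h).trans (le_abs_self _)

theorem card_le_of_cast_mem_Ico {N : ℕ} (S : Finset (Fin N)) {A B : ℝ} (hAB : A ≤ B)
    (hS : ∀ i ∈ S, A ≤ (i : ℝ) ∧ (i : ℝ) < B) : (S.card : ℝ) ≤ B - A + 1 := by
  have h1 : S.card ≤ (Finset.Ico ⌈A⌉ ⌈B⌉).card := by
    refine Finset.card_le_card_of_injOn (fun i => ((i : ℕ) : ℤ)) ?_ ?_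
    · intro i hi
      obtain ⟨h1, h2⟩ := hS i hi
      simp only [Finset.coe_Ico, mem_Ico]
      exact ⟨Int.ceil_le.2 (by exact_mod_cast h1), Int.lt_ceil.2 (by exact_mod_cast h2)⟩
    · intro i _ j _ hij
      exact Fin.ext (Int.ofNat_inj.1 hij)
  rw [Int.card_Ico] at h1
  have h2 : ((⌈B⌉ - ⌈A⌉).toNat : ℝ) = (⌈B⌉ : ℝ) - ⌈A⌉ := by
    have : 0 ≤ ⌈B⌉ - ⌈A⌉ := sub_nonneg.2 (Int.ceil_mono hAB)
    rw [← Int.cast_natCast, Int.toNat_of_nonneg this]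
    push_cast
    ring
  have h3 : (S.card : ℝ) ≤ ((⌈B⌉ - ⌈A⌉).toNat : ℝ) := by exact_mod_cast h1
  linarith [Int.le_ceil A, Int.ceil_lt_add_one B]

/-- The left side is `h (N d) / N` with `h x = x H(1/x)` non-increasing, so lower bounds on gaps
suffice to bound energies from above. -/
theorem minGap_mul_le {H : ℝ → ℝ} (hH : IsEnergyDensity H) {N : ℕ} (hN : 0 < N) {d y : ℝ}
    (hy : 0 < y) (hd : y ≤ N * d) : d * H (1 / (N * d)) ≤ y * H y⁻¹ / N := by
  have hN0 : (0 : ℝ) < N := by exact_mod_cast hN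
  have h := hH.antitone_h (mem_Ioi.2 hy) (mem_Ioi.2 (hy.trans_le hd)) hd
  rw [le_div_iff₀ hN0]
  calc _ = N * d * H (N * d)⁻¹ := by rw [one_div]; ring
    _ ≤ _ := h

/-- Group the particles by cell. A cell holds at most `N * m k + 1` of them, each charged the sharp
cost, and at most four near its ends are charged the crude cost in addition. -/
theorem particleEnergy_quantileParticles_le {H : ℝ → ℝ} (hH : IsEnergyDensity H) (hL : 0 < L)
    (hm : ∀ k, 0 ≤ m k) (hm1 : ∀ k, m k ≤ 1) {n : ℕ} (hn : cumMass m n = 1) {N : ℕ}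
    (hN : 2 ≤ N) :
    particleEnergy H (quantileParticles c L m N) ≤ ∑ k ∈ Finset.range n,
      ((m k + 1 / N) * (L / m k * H (L / m k)⁻¹) + 4 * (L * H L⁻¹) / N) := by
  classical
  have hN0 : (0 : ℝ) < N := by exact_mod_cast (by lia : 0 < N)
  have hhL : 0 ≤ L * H L⁻¹ := mul_nonneg hL.le (hH.nonneg _ (by positivity))
  have hspec := fun i : Fin N => cellIdx_spec (m := m) (n := n) (s := (i : ℝ) / N)
    (by positivity) (hn ▸ Fin.cast_div_lt_one i)
  rw [particleEnergy_eq, ← Finset.sum_fiberwise_of_maps_to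
    (g := fun i : Fin N => cellIdx m ((i : ℝ) / N)) (t := Finset.range n)
    fun i _ => Finset.mem_range.2 (hspec i).1]
  refine Finset.sum_le_sum fun k _ => ?_
  set S := Finset.univ.filter fun i : Fin N => cellIdx m ((i : ℝ) / N) = k with hS
  have hSm : ∀ i ∈ S, cumMass m k ≤ (i : ℝ) / N ∧ (i : ℝ) / N < cumMass m (k + 1) := by
    intro i hi
    have h1 := (hspec i).2
    rwa [(Finset.mem_filter.1 hi).2] at h1
  have hle : cumMass m k ≤ cumMass m (k + 1) := cumMass_mono hm k.le_succ
  -- `B₁` and `B₂` collect the particles whose left, respectively right, neighbouring level leaves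
  -- the cell; levels outside `[0, 1)` for the extreme particles are caught here too.
  set B₁ := S.filter fun i : Fin N => ((i : ℝ) - 1) / N < cumMass m k
  set B₂ := S.filter fun i : Fin N => cumMass m (k + 1) ≤ ((i : ℝ) + 1) / N
  have hcS : (S.card : ℝ) ≤ N * m k + 1 := by
    refine (card_le_of_cast_mem_Ico S (A := N * cumMass m k) (B := N * cumMass m (k + 1))
      (by gcongr) fun i hi => ?_).trans_eq ?_
    · have := hSm i hi
      rwa [le_div_iff₀' hN0, div_lt_iff₀' hN0] at this
    · rw [cumMass_succ]; ring
  have hcB₁ : (B₁.card : ℝ) ≤ 2 := by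
    refine (card_le_of_cast_mem_Ico B₁ (A := N * cumMass m k) (B := N * cumMass m k + 1)
      (by linarith) fun i hi => ?_).trans_eq (by ring)
    have h1 := (hSm i (Finset.mem_filter.1 hi).1).1
    have h2 := (Finset.mem_filter.1 hi).2
    rw [le_div_iff₀' hN0] at h1
    rw [div_lt_iff₀' hN0] at h2
    exact ⟨h1, by linarith⟩
  have hcB₂ : (B₂.card : ℝ) ≤ 2 := by
    refine (card_le_of_cast_mem_Ico B₂ (A := N * cumMass m (k + 1) - 1)
      (B := N * cumMass m (k + 1)) (by linarith) fun i hi => ?_).trans_eq (by ring)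
    have h1 := (hSm i (Finset.mem_filter.1 hi).1).2
    have h2 := (Finset.mem_filter.1 hi).2
    rw [div_lt_iff₀' hN0] at h1
    rw [le_div_iff₀' hN0] at h2
    exact ⟨by linarith, h1⟩
  set hk := L / m k * H (L / m k)⁻¹
  have hhk : 0 ≤ hk := by
    have : 0 ≤ L / m k := div_nonneg hL.le (hm k)
    exact mul_nonneg this (hH.nonneg _ (inv_nonneg.2 this))
  have hterm : ∀ i ∈ S, minGap (quantileParticles c L m N) i *
      H (1 / (N * minGap (quantileParticles c L m N) i)) ≤
      hk / N + (if i ∈ B₁ then L * H L⁻¹ / N else 0) + (if i ∈ B₂ then L * H L⁻¹ / N else 0) := by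
    intro i hi
    have hsm := hSm i hi
    have hmk : 0 < m k := by rw [cumMass_succ] at hsm; linarith
    have hbad := minGap_mul_le hH (by lia : 0 < N) hL
      (le_mul_minGap_quantileParticles (c := c) hL hm hm1 hn hN i)
    have hq : 0 ≤ L * H L⁻¹ / N := by positivity
    have hq' : 0 ≤ hk / N := by positivity
    by_cases h1 : i ∈ B₁
    · rw [if_pos h1]; split_ifs <;> linarith
    · by_cases h2 : i ∈ B₂
      · rw [if_pos h2, if_neg h1]; linarith
      · rw [if_neg h1, if_neg h2, add_zero, add_zero]
        refine minGap_mul_le hH (by lia : 0 < N) (by positivity)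
          (le_mul_minGap_of_interior hL hm hm1 hn hN ?_ ?_)
        · exact not_lt.1 fun h => h1 (Finset.mem_filter.2 ⟨hi, h⟩)
        · exact not_le.1 fun h => h2 (Finset.mem_filter.2 ⟨hi, h⟩)
  refine (Finset.sum_le_sum hterm).trans ?_
  rw [Finset.sum_add_distrib, Finset.sum_add_distrib, ← Finset.sum_filter, ← Finset.sum_filter,
    Finset.sum_const, Finset.sum_const, Finset.sum_const, nsmul_eq_mul, nsmul_eq_mul, nsmul_eq_mul]
  have hB₁ : ((S.filter (· ∈ B₁)).card : ℝ) ≤ 2 := le_trans (by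
    exact_mod_cast Finset.card_le_card fun i hi => (Finset.mem_filter.1 hi).2) hcB₁
  have hB₂ : ((S.filter (· ∈ B₂)).card : ℝ) ≤ 2 := le_trans (by
    exact_mod_cast Finset.card_le_card fun i hi => (Finset.mem_filter.1 hi).2) hcB₂
  calc _ ≤ (N * m k + 1) * (hk / N) + 2 * (L * H L⁻¹ / N) + 2 * (L * H L⁻¹ / N) := by
        gcongr
    _ = _ := by field_simp; ring

theorem eventually_particleEnergy_quantileParticles_lt {H : ℝ → ℝ} (hH : IsEnergyDensity H)
    (hL : 0 < L) (hm : ∀ k, 0 ≤ m k) (hm1 : ∀ k, m k ≤ 1) {n : ℕ} (hn : cumMass m n = 1) {e : ℝ}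
    (he : ∑ k ∈ Finset.range n, L * H (m k / L) < e) :
    ∀ᶠ N in atTop, particleEnergy H (quantileParticles c L m N) < e := by
  have hlim : Tendsto (fun N : ℕ => ∑ k ∈ Finset.range n,
      ((m k + 1 / N) * (L / m k * H (L / m k)⁻¹) + 4 * (L * H L⁻¹) / N)) atTop
      (𝓝 (∑ k ∈ Finset.range n, L * H (m k / L))) := by
    refine tendsto_finsetSum _ fun k _ => ?_
    have h1 : Tendsto (fun N : ℕ => (m k + 1 / N) * (L / m k * H (L / m k)⁻¹) +
        4 * (L * H L⁻¹) / N) atTop (𝓝 ((m k + 0) * (L / m k * H (L / m k)⁻¹) + 0)) :=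
      ((tendsto_one_div_atTop_nhds_zero_nat.const_add _).mul_const _).add
        (tendsto_const_div_atTop_nhds_zero_nat _)
    convert h1 using 2
    rcases (hm k).eq_or_lt with h | h
    -- For an empty cell the convention `L / 0 = 0` and `H 0 = 0` make both sides vanish.
    · simp [← h, hH.map_zero]
    · rw [inv_div]
      field_simp
      ring
  filter_upwards [hlim.eventually_lt_const he, eventually_ge_atTop 2] with N h1 h2
  exact (particleEnergy_quantileParticles_le hH hL hm hm1 hn h2).trans_lt h1

end StepQuantile

/-! ### The quantile coupling -/

theorem volume_inter_Ico_eq_sum {F : ℕ → ℝ} (hF : Monotone F) {A : Set ℝ} (hA : MeasurableSet A)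
    (n : ℕ) : volume (A ∩ Ico (F 0) (F n)) =
      ∑ i ∈ Finset.range n, volume (A ∩ Ico (F i) (F (i + 1))) := by
  induction n with
  | zero => simp
  | succ n ih =>
    rw [Finset.sum_range_succ, ← ih, ← Ico_union_Ico_eq_Ico (hF n.zero_le) (hF n.le_succ),
      inter_union_distrib_left, measure_union _ (hA.inter measurableSet_Ico)]
    exact (Ico_disjoint_Ico_same).mono inter_subset_right inter_subset_right

/-- The uniform distribution on `[0, 1)`. -/
noncomputable def unifMeasure : Measure ℝ := volume.restrict (Ico 0 1)

instance : IsProbabilityMeasure unifMeasure := ⟨by simp [unifMeasure]⟩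

theorem map_unifMeasure_floor {N : ℕ} (hN : 0 < N) (f : ℕ → ℝ) :
    unifMeasure.map (fun v : ℝ => f ⌊N * v⌋₊) = empirical fun i : Fin N => f i := by
  classical
  have hN0 : (0 : ℝ) < N := by exact_mod_cast hN
  have hmeas : Measurable fun v : ℝ => f ⌊N * v⌋₊ :=
    (measurable_from_nat (f := f)).comp (Nat.measurable_floor.comp (measurable_const_mul _))
  ext A hA
  have hpre := hmeas hA
  rw [empirical_apply _ hA, Measure.map_apply hmeas hA, unifMeasure, Measure.restrict_apply hpre]
  have hF : Monotone fun i : ℕ => (i : ℝ) / N := fun i j hij => by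
    have : (i : ℝ) ≤ j := by exact_mod_cast hij
    simp only
    gcongr
  have h1 := volume_inter_Ico_eq_sum hF hpre N
  simp only [Nat.cast_zero, zero_div, div_self hN0.ne'] at h1
  have h2 : ∀ i : ℕ, volume ((fun v : ℝ => f ⌊N * v⌋₊) ⁻¹' A ∩
      Ico ((i : ℝ) / N) (((i + 1 : ℕ) : ℝ) / N)) = if f i ∈ A then (N : ℝ≥0∞)⁻¹ else 0 := by
    intro i
    have hfl : ∀ v ∈ Ico ((i : ℝ) / N) (((i + 1 : ℕ) : ℝ) / N), ⌊N * v⌋₊ = i := by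
      intro v hv
      rw [mem_Ico, div_le_iff₀' hN0, lt_div_iff₀' hN0] at hv
      rw [Nat.floor_eq_iff ((Nat.cast_nonneg i).trans hv.1)]
      exact ⟨hv.1, by simpa using hv.2⟩
    split_ifs with h
    · rw [inter_eq_right.2 fun v hv => by rw [mem_preimage, hfl v hv]; exact h, Real.volume_Ico,
        ← sub_div]
      simp [ENNReal.ofReal_inv_of_pos hN0]
    · have : (fun v : ℝ => f ⌊N * v⌋₊) ⁻¹' A ∩
          Ico ((i : ℝ) / N) (((i + 1 : ℕ) : ℝ) / N) = ∅ := by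
        refine eq_empty_of_forall_notMem fun v hv => h ?_
        have := hv.1
        rwa [mem_preimage, hfl v hv.2] at this
      rw [this, measure_empty]
  rw [h1, Finset.sum_congr rfl fun i _ => h2 i,
    Finset.sum_range fun i => if f i ∈ A then (N : ℝ≥0∞)⁻¹ else 0, ← Finset.sum_filter,
    Finset.sum_const, nsmul_eq_mul, mul_comm]

section Coupling

variable {ρ : Measure ℝ} {κ : ℝ → ℕ} {n : ℕ}

/-- The mass of the `k`-th cell. -/
noncomputable def cellMass (ρ : Measure ℝ) (κ : ℝ → ℕ) (k : ℕ) : ℝ := ρ.real (κ ⁻¹' {k})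

theorem cellMass_nonneg (k : ℕ) : 0 ≤ cellMass ρ κ k := measureReal_nonneg

theorem cellMass_le_one [IsProbabilityMeasure ρ] (k : ℕ) : cellMass ρ κ k ≤ 1 := measureReal_le_one

theorem cumMass_cellMass [IsProbabilityMeasure ρ] (hκ : Measurable κ) (hn : ∀ x, κ x < n) :
    cumMass (cellMass ρ κ) n = 1 := by
  have h : (⋃ k ∈ Finset.range n, κ ⁻¹' {k}) = univ := by
    ext x
    simp [hn x]
  simp only [cumMass, cellMass]
  rw [← measureReal_biUnion_finset, h, probReal_univ]
  · intro i _ j _ hij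
    exact Disjoint.preimage _ (by simpa using hij)
  · exact fun k _ => hκ (measurableSet_singleton k)

/-- The level of a point of `ℝ` in the quantile coupling, with an independent uniform variable
that spreads the mass of each cell. -/
noncomputable def quantileLevel (ρ : Measure ℝ) (κ : ℝ → ℕ) (z : ℝ × ℝ) : ℝ :=
  cumMass (cellMass ρ κ) (κ z.1) + cellMass ρ κ (κ z.1) * z.2

theorem measurable_quantileLevel (hκ : Measurable κ) : Measurable (quantileLevel ρ κ) :=
  ((measurable_from_nat (f := cumMass (cellMass ρ κ))).comp (hκ.comp measurable_fst)).add
    (((measurable_from_nat (f := cellMass ρ κ)).comp (hκ.comp measurable_fst)).mul measurable_snd)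

/-- Conditionally on cell `k`, the level is uniform on `[cumMass k, cumMass (k + 1))`, an interval
whose length is the probability of that cell. The auxiliary uniform variable makes this work even
when `ρ` has atoms. -/
theorem map_quantileLevel [IsProbabilityMeasure ρ] (hκ : Measurable κ) (hn : ∀ x, κ x < n) :
    (ρ.prod unifMeasure).map (quantileLevel ρ κ) = unifMeasure := by
  have hV := measurable_quantileLevel (ρ := ρ) hκ
  set m := cellMass ρ κ with hm
  have hm0 : ∀ k, 0 ≤ m k := fun k => cellMass_nonneg k
  ext A hA
  rw [Measure.map_apply hV hA, Measure.prod_apply (hV hA)]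
  set g : ℕ → ℝ≥0∞ := fun k => unifMeasure ((fun u => cumMass m k + m k * u) ⁻¹' A)
  have h1 : ∀ x, unifMeasure (Prod.mk x ⁻¹' (quantileLevel ρ κ ⁻¹' A)) = g (κ x) := fun x => rfl
  simp only [h1]
  have hgk : ∀ k, g k * ρ (κ ⁻¹' {k}) = volume (A ∩ Ico (cumMass m k) (cumMass m (k + 1))) := by
    intro k
    have hρk : ρ (κ ⁻¹' {k}) = ENNReal.ofReal (m k) := by simp [hm, cellMass, ofReal_measureReal]
    rcases (hm0 k).eq_or_lt with h | h
    · rw [hρk, cumMass_succ, ← h]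
      simp
    · have h2 : (fun u => cumMass m k + m k * u) ⁻¹' A ∩ Ico 0 1 =
          (fun u => m k * u) ⁻¹' ((fun y => cumMass m k + y) ⁻¹'
            (A ∩ Ico (cumMass m k) (cumMass m (k + 1)))) := by
        ext u
        simp only [mem_inter_iff, mem_preimage, mem_Ico, cumMass_succ, le_add_iff_nonneg_right,
          add_lt_add_iff_left, mul_nonneg_iff_of_pos_left h, mul_lt_iff_lt_one_right h]
      have hpm : MeasurableSet ((fun u => cumMass m k + m k * u) ⁻¹' A) :=
        ((measurable_const_mul (m k)).const_add (cumMass m k)) hA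
      simp only [g]
      rw [unifMeasure, Measure.restrict_apply hpm, h2, Real.volume_preimage_mul_left h.ne',
        measure_preimage_add, hρk, mul_right_comm, abs_of_pos (inv_pos.2 h),
        ← ENNReal.ofReal_mul (inv_nonneg.2 h.le), inv_mul_cancel₀ h.ne', ENNReal.ofReal_one,
        one_mul]
  have h3 : ∫⁻ x, g (κ x) ∂ρ = ∑ k ∈ Finset.range n, g k * ρ (κ ⁻¹' {k}) := by
    rw [← lintegral_map (f := g) measurable_from_nat hκ, lintegral_countable']
    simp only [Measure.map_apply hκ (measurableSet_singleton _)]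
    refine tsum_eq_sum fun k hk => ?_
    have : κ ⁻¹' {k} = ∅ := by
      refine eq_empty_of_forall_notMem fun x hx => hk ?_
      rw [← mem_singleton_iff.1 hx]
      exact Finset.mem_range.2 (hn x)
    simp [this]
  rw [h3, Finset.sum_congr rfl fun k _ => hgk k, ← volume_inter_Ico_eq_sum (cumMass_mono hm0) hA,
    cumMass_zero, cumMass_cellMass hκ hn, unifMeasure, Measure.restrict_apply hA]

/-- The particle to which the quantile coupling sends a point. -/
noncomputable def coupledParticle (c L : ℝ) (ρ : Measure ℝ) (κ : ℝ → ℕ) (N : ℕ) (z : ℝ × ℝ) : ℝ :=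
  stepQuantile c L (cellMass ρ κ) (⌊N * quantileLevel ρ κ z⌋₊ / N)

theorem measurable_coupledParticle (c L : ℝ) (hκ : Measurable κ) (N : ℕ) :
    Measurable (coupledParticle c L ρ κ N) :=
  (measurable_from_nat (f := fun i => stepQuantile c L (cellMass ρ κ) (i / N))).comp
    (Nat.measurable_floor.comp ((measurable_quantileLevel hκ).const_mul _))

/-- Rounding a uniform level down to a multiple of `1 / N` chooses each particle with probability `1
/ N`, so pairing the resulting particle with the original point is a coupling. -/
theorem wassersteinDist_quantileParticles_le [IsProbabilityMeasure ρ] (c L : ℝ) (hκ : Measurable κ) (hn : ∀ x, κ x < n)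
    (p : ℝ) {N : ℕ} (hN : 0 < N) :
    wassersteinDist p (empirical (quantileParticles c L (cellMass ρ κ) N)) ρ ≤
      (∫⁻ z, edist (coupledParticle c L ρ κ N z) z.1 ^ p ∂(ρ.prod unifMeasure)) ^ (1 / p) := by
  have hY := measurable_coupledParticle (ρ := ρ) c L hκ N
  have hYm : Measurable fun z : ℝ × ℝ => (coupledParticle c L ρ κ N z, z.1) :=
    hY.prodMk measurable_fst
  refine (iInf₂_le ((ρ.prod unifMeasure).map fun z => (coupledParticle c L ρ κ N z, z.1))
    ⟨Measure.isProbabilityMeasure_map hYm.aemeasurable, ?_, ?_⟩).trans_eq ?_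
  rotate_left
  · rw [Measure.map_map measurable_fst hYm]
    have hfl : Measurable fun v : ℝ => stepQuantile c L (cellMass ρ κ) ((⌊N * v⌋₊ : ℝ) / N) :=
      (measurable_from_nat (f := fun i : ℕ => stepQuantile c L (cellMass ρ κ) (i / N))).comp
        (Nat.measurable_floor.comp (measurable_const_mul _))
    have h1 := Measure.map_map (μ := ρ.prod unifMeasure) hfl (measurable_quantileLevel (ρ := ρ) hκ)
    rw [map_quantileLevel hκ hn, map_unifMeasure_floor hN
      fun i => stepQuantile c L (cellMass ρ κ) (i / N)] at h1
    exact h1.symm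
  · rw [Measure.map_map measurable_snd hYm]
    exact measurePreserving_fst.map_eq
  · congr 1
    exact lintegral_map ((measurable_fst.edist measurable_snd).pow_const p) hYm

/-- Reverse Fatou, dominated through the finite `p`-th moment. Almost surely the level lies strictly
inside the level interval of its cell, so for large `N` the rounded level does too and the particle
lands in the cell of `x`. -/
theorem limsup_lintegral_coupledParticle_le [IsProbabilityMeasure ρ] {c L : ℝ} (hL : 0 < L) (hκ : Measurable κ)
    (hn : ∀ x, κ x < n) {p : ℝ} (hp : 1 < p) (hρp : ∫⁻ x, ‖x‖ₑ ^ p ∂ρ < ∞) {D : ℝ → ℝ≥0∞}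
    (hDm : Measurable D)
    (hD : ∀ᵐ x ∂ρ, ∀ y ∈ Icc (c + L * κ x) (c + L * (κ x + 1)), edist y x ≤ D x) :
    limsup (fun N : ℕ => ∫⁻ z, edist (coupledParticle c L ρ κ N z) z.1 ^ p ∂(ρ.prod unifMeasure))
      atTop ≤ ∫⁻ x, D x ^ p ∂ρ := by
  have hp0 : 0 < p := by linarith
  set m := cellMass ρ κ with hm
  have hm0 : ∀ k, 0 ≤ m k := fun k => cellMass_nonneg k
  have hcum := cumMass_cellMass (ρ := ρ) hκ hn
  have hpos : ∀ᵐ x ∂ρ, 0 < m (κ x) := by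
    have : ∀ᵐ x ∂ρ, ∀ k, m k = 0 → κ x ≠ k := by
      refine ae_all_iff.2 fun k => ?_
      by_cases hk : m k = 0
      · have h0 : ρ (κ ⁻¹' {k}) = 0 := (measureReal_eq_zero_iff).1 hk
        have : ∀ᵐ x ∂ρ, κ x ≠ k := by
          rw [ae_iff]
          simpa [preimage, mem_singleton_iff] using h0
        exact this.mono fun x hx _ => hx
      · exact Eventually.of_forall fun x h => absurd h hk
    exact this.mono fun x hx => lt_of_le_of_ne (hm0 _) fun h => hx _ h.symm rfl
  -- Excluding `u = 0` matters: rounding goes downwards and could otherwise fall into the preceding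
  -- cell for infinitely many `N`.
  have hunif : ∀ᵐ u ∂unifMeasure, u ∈ Ioo (0 : ℝ) 1 := by
    rw [unifMeasure, ← restrict_Ioo_eq_restrict_Ico]
    exact ae_restrict_mem measurableSet_Ioo
  have hlevel : ∀ᵐ z ∂(ρ.prod unifMeasure), cumMass m (κ z.1) < quantileLevel ρ κ z ∧
      quantileLevel ρ κ z < cumMass m (κ z.1 + 1) := by
    filter_upwards [Measure.quasiMeasurePreserving_fst.ae hpos,
      Measure.quasiMeasurePreserving_snd.ae hunif] with z h1 h2
    rw [quantileLevel, ← hm, cumMass_succ]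
    constructor <;> nlinarith [h2.1, h2.2]
  have hbound : ∀ N : ℕ, (fun z => edist (coupledParticle c L ρ κ N z) z.1 ^ p)
      ≤ᵐ[ρ.prod unifMeasure] fun z => (‖z.1‖ₑ + ENNReal.ofReal (|c| + L * n)) ^ p := by
    intro N
    filter_upwards [hlevel] with z hz
    have h0 : 0 ≤ quantileLevel ρ κ z :=
      ((cumMass_zero m).symm.le.trans (cumMass_mono hm0 (Nat.zero_le _))).trans hz.1.le
    have h1 : quantileLevel ρ κ z < cumMass m n := hz.2.trans_le (cumMass_mono hm0 (hn z.1))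
    have h2 : (⌊N * quantileLevel ρ κ z⌋₊ : ℝ) / N ≤ quantileLevel ρ κ z := by
      rcases N.eq_zero_or_pos with h | h
      · simpa [h] using h0
      · rw [div_le_iff₀' (by exact_mod_cast h)]
        exact Nat.floor_le (by positivity)
    have h3 := stepQuantile_mem_Icc (c := c) hL hm0 (n := n) (by positivity) (h2.trans_lt h1)
    refine ENNReal.rpow_le_rpow ?_ hp0.le
    rw [edist_comm, edist_eq_enorm_sub]
    refine (enorm_sub_le (E := ℝ)).trans ?_
    gcongr
    rw [Real.enorm_eq_ofReal_abs]
    refine ENNReal.ofReal_le_ofReal (abs_le.2 ⟨?_, ?_⟩)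
    · have : 0 ≤ L * n := by positivity
      linarith [neg_abs_le c, h3.1, show coupledParticle c L ρ κ N z = stepQuantile c L m
        (⌊N * quantileLevel ρ κ z⌋₊ / N) from rfl]
    · linarith [le_abs_self c, h3.2, show coupledParticle c L ρ κ N z = stepQuantile c L m
        (⌊N * quantileLevel ρ κ z⌋₊ / N) from rfl]
  have hfst : MeasurePreserving Prod.fst (ρ.prod unifMeasure) ρ := measurePreserving_fst
  have hint : ∫⁻ z, (‖z.1‖ₑ + ENNReal.ofReal (|c| + L * n)) ^ p ∂(ρ.prod unifMeasure) ≠ ∞ := by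
    rw [hfst.lintegral_comp (f := fun x : ℝ => (‖x‖ₑ + ENNReal.ofReal (|c| + L * n)) ^ p)
      (by fun_prop)]
    refine ne_top_of_le_ne_top ?_ (lintegral_mono fun x =>
      ENNReal.rpow_add_le_mul_rpow_add_rpow ‖x‖ₑ (ENNReal.ofReal (|c| + L * n)) hp.le)
    rw [lintegral_const_mul _ (by fun_prop), lintegral_add_right _ measurable_const]
    simp only [lintegral_const, measure_univ, mul_one]
    have h1 : (2 : ℝ≥0∞) ^ (p - 1) ≠ ∞ := ENNReal.rpow_ne_top_of_nonneg (by linarith) (by simp)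
    have h2 : ENNReal.ofReal (|c| + L * n) ^ p ≠ ∞ :=
      ENNReal.rpow_ne_top_of_nonneg hp0.le ENNReal.ofReal_ne_top
    exact ENNReal.mul_ne_top h1 (ENNReal.add_ne_top.2 ⟨hρp.ne, h2⟩)
  refine (limsup_lintegral_le _ (fun N => ((measurable_coupledParticle c L hκ N).edist
    measurable_fst).pow_const p) hbound hint).trans ?_
  rw [← hfst.lintegral_comp (hDm.pow_const p)]
  refine lintegral_mono_ae ?_
  filter_upwards [hlevel, Measure.quasiMeasurePreserving_fst.ae hD] with z hz hDz
  refine limsup_le_of_le (by isBoundedDefault) ?_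
  have h0 : 0 ≤ quantileLevel ρ κ z :=
    ((cumMass_zero m).symm.le.trans (cumMass_mono hm0 (Nat.zero_le _))).trans hz.1.le
  have hlim : Tendsto (fun N : ℕ => (⌊N * quantileLevel ρ κ z⌋₊ : ℝ) / N) atTop
      (𝓝 (quantileLevel ρ κ z)) := by
    have := (tendsto_nat_floor_mul_div_atTop h0).comp (tendsto_natCast_atTop_atTop (R := ℝ))
    simpa [Function.comp_def, mul_comm] using this
  filter_upwards [hlim.eventually_const_lt hz.1, hlim.eventually_lt_const hz.2] with N h1 h2
  exact ENNReal.rpow_le_rpow (hDz _ (stepQuantile_mem_cell hL hm0 h1.le h2)) hp0.le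

end Coupling

/-! ### Approximation by step densities -/

/-- Jensen's inequality for the average of the density over one cell. -/
theorem cell_energy_le {H : ℝ → ℝ} (hH : IsEnergyDensity H) {ρ : Measure ℝ} [IsFiniteMeasure ρ]
    (hac : ρ ≪ volume) {a b : ℝ} (hab : a < b) :
    ENNReal.ofReal ((b - a) * H (ρ.real (Ico a b) / (b - a))) ≤
      ∫⁻ x in Ico a b, ENNReal.ofReal (H (ρ.rnDeriv volume x).toReal) := by
  rcases eq_or_ne (∫⁻ x in Ico a b, ENNReal.ofReal (H (ρ.rnDeriv volume x).toReal)) ∞ with h | h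
  · simp [h]
  have hl : 0 < b - a := sub_pos.2 hab
  have hv : volume.real (Ico a b) = b - a := Real.volume_real_Ico_of_le hab.le
  set f : ℝ → ℝ := fun x => (ρ.rnDeriv volume x).toReal with hf
  have hfm : Measurable f := (Measure.measurable_rnDeriv _ _).ennreal_toReal
  have hf0 : ∀ x, 0 ≤ f x := fun x => ENNReal.toReal_nonneg
  have hHfm : Measurable fun x => H (f x) := by
    have := hH.continuous_max.measurable.comp hfm
    simpa [Function.comp_def, hf0] using this
  have hint : IntegrableOn (fun x => H (f x)) (Ico a b) := by
    refine ⟨hHfm.aestronglyMeasurable, ?_⟩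
    rw [hasFiniteIntegral_iff_ofReal (Eventually.of_forall fun x => hH.nonneg _ (hf0 x))]
    exact lt_top_iff_ne_top.2 h
  have hJ := hH.convex.map_set_average_le hH.continuous isClosed_Ici (t := Ico a b) (f := f)
    (by simpa using hab) measure_Ico_lt_top.ne
    (Eventually.of_forall fun x => hf0 x)
    (Measure.integrable_toReal_rnDeriv (μ := ρ) (ν := volume)).integrableOn hint
  rw [setAverage_eq, setAverage_eq, Measure.setIntegral_toReal_rnDeriv hac, hv, smul_eq_mul,
    smul_eq_mul, inv_mul_eq_div, inv_mul_eq_div, le_div_iff₀' hl] at hJ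
  refine (ENNReal.ofReal_le_ofReal hJ).trans_eq (ofReal_integral_eq_lintegral_ofReal hint
    (Eventually.of_forall fun x => hH.nonneg _ (hf0 x)))

theorem sum_cell_energy_le {H : ℝ → ℝ} (hH : IsEnergyDensity H) {ρ : Measure ℝ}
    [IsFiniteMeasure ρ] (hac : ρ ≪ volume) {c L : ℝ} (hL : 0 < L) {K : ℕ} {Ω : Set ℝ}
    (hΩ : Ico c (c + L * K) ⊆ Ω) :
    ENNReal.ofReal (∑ k ∈ Finset.range K,
      L * H (ρ.real (Ico (c + L * k) (c + L * (k + 1))) / L)) ≤ energy H Ω ρ := by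
  have hlen : ∀ k : ℕ, c + L * (k + 1) - (c + L * k) = L := fun k => by ring
  rw [energy, if_pos hac, ENNReal.ofReal_sum_of_nonneg fun k _ =>
    mul_nonneg hL.le (hH.nonneg _ (div_nonneg measureReal_nonneg hL.le))]
  have hF : Monotone fun k : ℕ => c + L * (k : ℝ) := fun i j hij => by
    have : (i : ℝ) ≤ j := by exact_mod_cast hij
    simp only
    gcongr
  have hd : Pairwise (Function.onFun Disjoint fun k : ℕ => Ico (c + L * k) (c + L * (k + 1))) := by
    have := hF.pairwise_disjoint_on_Ico_succ
    simpa [Nat.succ_eq_add_one] using this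
  calc _ ≤ ∑ k ∈ Finset.range K, ∫⁻ x in Ico (c + L * k) (c + L * (k + 1)),
          ENNReal.ofReal (H (ρ.rnDeriv volume x).toReal) := by
        refine Finset.sum_le_sum fun k _ => ?_
        have := cell_energy_le hH hac (a := c + L * k) (b := c + L * (k + 1)) (by linarith)
        rwa [hlen] at this
    _ = ∫⁻ x in ⋃ k ∈ Finset.range K, Ico (c + L * k) (c + L * (k + 1)),
          ENNReal.ofReal (H (ρ.rnDeriv volume x).toReal) :=
        (lintegral_biUnion_finset (fun i _ j _ hij => hd hij) (fun _ _ => measurableSet_Ico) _).symm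
    _ ≤ _ := by
        refine lintegral_mono_set (Subset.trans (iUnion₂_subset fun k hk => ?_) hΩ)
        have hk' : (k : ℝ) + 1 ≤ K := by exact_mod_cast Finset.mem_range.1 hk
        refine Ico_subset_Ico (by simpa using mul_nonneg hL.le k.cast_nonneg) ?_
        gcongr

/-! ### Finite grids with one overflow cell -/

open scoped Classical in
/-- The index of the cell of a grid of `K` cells that contains a point, or `K` if there is none. -/
noncomputable def gridCell (c L : ℝ) (K : ℕ) (x : ℝ) : ℕ :=
  if x ∈ Ico c (c + L * K) then ⌊(x - c) / L⌋₊ else K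

section GridCell

variable {c L : ℝ} {K : ℕ}

theorem measurable_gridCell : Measurable (gridCell c L K) :=
  Measurable.ite measurableSet_Ico (Nat.measurable_floor.comp ((measurable_id.sub_const c).div_const L))
    measurable_const

theorem gridCell_of_notMem {x : ℝ} (h : x ∉ Ico c (c + L * K)) : gridCell c L K x = K := if_neg h

theorem gridCell_eq_iff (hL : 0 < L) {x : ℝ} (h : x ∈ Ico c (c + L * K)) (k : ℕ) :
    gridCell c L K x = k ↔ x ∈ Ico (c + L * k) (c + L * (k + 1)) := by
  rw [gridCell, if_pos h, Nat.floor_eq_iff (div_nonneg (sub_nonneg.2 h.1) hL.le),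
    le_div_iff₀' hL, div_lt_iff₀' hL, mem_Ico, le_sub_iff_add_le', sub_lt_iff_lt_add']

theorem gridCell_lt_of_mem (hL : 0 < L) {x : ℝ} (h : x ∈ Ico c (c + L * K)) :
    gridCell c L K x < K := by
  have h1 := (gridCell_eq_iff hL h _).1 rfl
  by_contra! hK
  have h2 : (K : ℝ) ≤ gridCell c L K x := by exact_mod_cast hK
  have : L * K ≤ L * gridCell c L K x := by gcongr
  linarith [h1.1, h.2]

theorem gridCell_lt (hL : 0 < L) (x : ℝ) : gridCell c L K x < K + 1 := by
  by_cases h : x ∈ Ico c (c + L * K)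
  · exact (gridCell_lt_of_mem hL h).trans K.lt_succ_self
  · rw [gridCell_of_notMem h]; exact K.lt_succ_self

theorem gridCell_preimage_of_lt (hL : 0 < L) {k : ℕ} (hk : k < K) :
    gridCell c L K ⁻¹' {k} = Ico (c + L * k) (c + L * (k + 1)) := by
  have hk' : (k : ℝ) + 1 ≤ K := by exact_mod_cast hk
  have h1 : L * ((k : ℝ) + 1) ≤ L * K := by gcongr
  have h0 : 0 ≤ L * k := by positivity
  ext x
  rw [mem_preimage, mem_singleton_iff]
  by_cases h : x ∈ Ico c (c + L * K)
  · exact gridCell_eq_iff hL h k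
  · rw [gridCell_of_notMem h]
    refine iff_of_false hk.ne' fun hx => h ⟨?_, ?_⟩ <;> linarith [hx.1, hx.2]

theorem gridCell_preimage_last (hL : 0 < L) :
    gridCell c L K ⁻¹' {K} = (Ico c (c + L * K))ᶜ := by
  ext x
  rw [mem_preimage, mem_singleton_iff, mem_compl_iff]
  by_cases h : x ∈ Ico c (c + L * K)
  · exact iff_of_false (gridCell_lt_of_mem hL h).ne (not_not.2 h)
  · exact iff_of_true (gridCell_of_notMem h) h

theorem edist_le_of_mem_Icc {x y a b : ℝ} (hx : x ∈ Icc a b) (hy : y ∈ Icc a b) :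
    edist y x ≤ ENNReal.ofReal (b - a) := by
  rw [edist_dist]
  exact ENNReal.ofReal_le_ofReal (Real.dist_le_of_mem_Icc hy hx)

theorem edist_gridCell_le (hL : 0 < L) {x y : ℝ} (h : x ∈ Ico c (c + L * K))
    (hy : y ∈ Icc (c + L * gridCell c L K x) (c + L * (gridCell c L K x + 1))) :
    edist y x ≤ ENNReal.ofReal L := by
  refine (edist_le_of_mem_Icc (Ico_subset_Icc_self ((gridCell_eq_iff hL h _).1 rfl)) hy).trans_eq ?_
  congr 1
  ring

end GridCell

/-- A finite grid in `Ω` such that spreading `ρ` uniformly over the cells barely increases the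
energy and moves the mass of `ρ` by a small amount. -/
def HasFineGrid (p : ℝ) (Ω : Set ℝ) (H : ℝ → ℝ) (ρ : Measure ℝ) (ε : ℝ) : Prop :=
  ∃ (c L : ℝ) (K : ℕ) (D : ℝ → ℝ≥0∞), 0 < L ∧ Icc c (c + L * (K + 1)) ⊆ Ω ∧ Measurable D ∧
    (∀ᵐ x ∂ρ, ∀ y ∈ Icc (c + L * gridCell c L K x) (c + L * (gridCell c L K x + 1)),
      edist y x ≤ D x) ∧
    ∫⁻ x, D x ^ p ∂ρ ≤ ENNReal.ofReal ε ∧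
    ENNReal.ofReal (∑ k ∈ Finset.range (K + 1), L * H (cellMass ρ (gridCell c L K) k / L)) ≤
      energy H Ω ρ + ENNReal.ofReal ε

/-- Here `K + 1` equal cells fill `[a, b]`, and the overflow cell is simply the last one, with the
endpoint `b` included. -/
theorem hasFineGrid_Icc {p : ℝ} (hp : 1 < p) {H : ℝ → ℝ} (hH : IsEnergyDensity H) {ρ : Measure ℝ}
    [IsProbabilityMeasure ρ] {a b : ℝ} (hab : a < b) (hρ : ρ (Icc a b)ᶜ = 0) {ε : ℝ} (hε : 0 < ε) :
    HasFineGrid p (Icc a b) H ρ ε := by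
  have hp0 : 0 < p := by linarith
  have hlim : Tendsto (fun K : ℕ => ((b - a) / ((K : ℝ) + 1)) ^ p) atTop (𝓝 0) := by
    have h1 : Tendsto (fun K : ℕ => (b - a) / ((K : ℝ) + 1)) atTop (𝓝 0) := by
      simpa [div_eq_mul_inv] using tendsto_one_div_add_atTop_nhds_zero_nat.const_mul (b - a)
    simpa [Real.zero_rpow hp0.ne'] using h1.rpow_const (Or.inr hp0.le)
  obtain ⟨K, hK⟩ := (hlim.eventually_lt_const hε).exists
  set L := (b - a) / ((K : ℝ) + 1) with hLdef
  have hL : 0 < L := div_pos (sub_pos.2 hab) (by positivity)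
  have hb : a + L * (K + 1) = b := by
    rw [hLdef, div_mul_cancel₀ _ (by positivity)]; ring
  have hmem : ∀ᵐ x ∂ρ, x ∈ Icc a b := by
    rw [ae_iff]; exact hρ
  refine ⟨a, L, K, fun _ => ENNReal.ofReal L, hL, by rw [hb], measurable_const, ?_, ?_, ?_⟩
  · filter_upwards [hmem] with x hx y hy
    by_cases h : x ∈ Ico a (a + L * K)
    · exact edist_gridCell_le hL h hy
    · rw [gridCell_of_notMem h] at hy
      have hx' : x ∈ Icc (a + L * K) (a + L * (K + 1)) := by
        rw [hb]
        exact ⟨not_lt.1 fun h' => h ⟨hx.1, h'⟩, hx.2⟩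
      refine (edist_le_of_mem_Icc hx' hy).trans_eq ?_
      congr 1
      ring
  · rw [lintegral_const, measure_univ, mul_one, ENNReal.ofReal_rpow_of_pos hL]
    exact ENNReal.ofReal_le_ofReal hK.le
  · by_cases hac : ρ ≪ volume
    swap
    · simp [energy, hac]
    refine le_trans (le_trans (le_of_eq ?_) (sum_cell_energy_le hH hac hL (c := a) (K := K + 1)
      (Ω := Icc a b) ?_)) le_self_add
    · congr 1
      refine Finset.sum_congr rfl fun k hk => ?_
      congr 3
      rcases Nat.lt_succ_iff_lt_or_eq.1 (Finset.mem_range.1 hk) with h | h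
      · rw [cellMass, gridCell_preimage_of_lt hL h]
      · rw [cellMass, h, gridCell_preimage_last hL, hb]
        refine measureReal_congr ?_
        -- The overflow cell and the half-open last cell differ, up to `ρ`-null sets, only by the
        -- point `b`, which is negligible for absolutely continuous `ρ`.
        have hne : ∀ᵐ x ∂ρ, x ≠ b := by
          rw [ae_iff]
          simpa using hac (Real.volume_singleton (a := b))
        filter_upwards [hmem, hne] with x hx hxb
        have h0 : 0 ≤ L * K := by positivity
        refine propext ⟨fun h' => ⟨not_lt.1 fun h'' => h' ⟨hx.1, h''⟩, lt_of_le_of_ne hx.2 hxb⟩,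
          fun h' h'' => absurd h''.2 (not_lt.2 h'.1)⟩
    · push_cast
      rw [hb]
      exact Ico_subset_Icc_self

/-- Fix `L` first, then cut off at `±M L` and send both tails to one extra cell `[M L, M L + L]`. As
`M` grows, its energy tends to `H 0 = 0` times `L`, and its transport cost is a tail of the `p`-th
moment. -/
theorem hasFineGrid_univ {p : ℝ} (hp : 1 < p) {H : ℝ → ℝ} (hH : IsEnergyDensity H) {ρ : Measure ℝ}
    [IsProbabilityMeasure ρ] (hρ : ∫⁻ x, ‖x‖ₑ ^ p ∂ρ < ∞) {ε : ℝ} (hε : 0 < ε) :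
    HasFineGrid p univ H ρ ε := by
  have hp0 : 0 < p := by linarith
  obtain ⟨L, hL, hLp⟩ : ∃ L : ℝ, 0 < L ∧ L ^ p = ε / 2 :=
    ⟨(ε / 2) ^ (1 / p), by positivity, by
      rw [← Real.rpow_mul (by positivity), one_div, inv_mul_cancel₀ hp0.ne', Real.rpow_one]⟩
  set s : ℕ → Set ℝ := fun M => (Ico (-(M * L)) (M * L))ᶜ with hs
  have hsm : ∀ M, MeasurableSet (s M) := fun M => measurableSet_Ico.compl
  have htail : Tendsto (fun M => ρ (s M)) atTop (𝓝 0) := by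
    have hanti : Antitone s := by
      intro M M' h
      have h' : (M : ℝ) ≤ M' := by exact_mod_cast h
      have : (M : ℝ) * L ≤ M' * L := by gcongr
      exact compl_subset_compl.2 (Ico_subset_Ico (by linarith) this)
    have h1 := tendsto_measure_iInter_atTop (μ := ρ) (fun M => (hsm M).nullMeasurableSet) hanti
      ⟨0, measure_ne_top _ _⟩
    have h2 : ⋂ M, s M = ∅ := by
      refine eq_empty_of_forall_notMem fun x hx => ?_
      obtain ⟨M, hM⟩ := exists_nat_gt (|x| / L)
      rw [div_lt_iff₀ hL, abs_lt] at hM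
      exact mem_iInter.1 hx M ⟨hM.1.le, hM.2⟩
    rwa [h2, measure_empty] at h1
  have hmom : Tendsto (fun M => ∫⁻ x in s M, (3 * ‖x‖ₑ) ^ p ∂ρ) atTop (𝓝 0) := by
    refine tendsto_setLIntegral_zero ?_ htail
    simp only [ENNReal.mul_rpow_of_nonneg _ _ hp0.le]
    rw [lintegral_const_mul _ (by fun_prop)]
    exact ENNReal.mul_ne_top (ENNReal.rpow_ne_top_of_nonneg hp0.le (by simp)) hρ.ne
  have hlast : Tendsto (fun M => L * H (ρ.real (s M) / L)) atTop (𝓝 0) := by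
    have h1 : Tendsto (fun M => ρ.real (s M) / L) atTop (𝓝 0) := by
      simpa [Measure.real] using ((ENNReal.tendsto_toReal ENNReal.zero_ne_top).comp htail).div_const L
    simpa [hH.map_zero] using
      (hH.tendsto (fun M => div_nonneg measureReal_nonneg hL.le) le_rfl h1).const_mul L
  obtain ⟨M, hM1, hM2, hM3⟩ := ((hmom.eventually_lt_const
    (ENNReal.ofReal_pos.2 (half_pos hε))).and ((hlast.eventually_lt_const hε).and
    (eventually_ge_atTop 1))).exists
  have hM3' : (1 : ℝ) ≤ M := by exact_mod_cast hM3
  have hML : L ≤ M * L := le_mul_of_one_le_left hL.le hM3'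
  set c : ℝ := -(M * L) with hc
  have hcK : c + L * ((2 * M : ℕ) : ℝ) = M * L := by rw [hc]; push_cast; ring
  have hlastcell : (Ico c (c + L * ((2 * M : ℕ) : ℝ)))ᶜ = s M := by rw [hcK]
  classical
  -- Since `M ≥ 1`, a point `y` of the extra cell satisfies `y ≤ 2 M L ≤ 2 |x|` for `x` in the
  -- tails, hence the factor `3`.
  refine ⟨c, L, 2 * M, fun x => if x ∈ s M then 3 * ‖x‖ₑ else ENNReal.ofReal L, hL, subset_univ _,
    Measurable.ite (hsm M) (by fun_prop) measurable_const, ?_, ?_, ?_⟩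
  · refine Eventually.of_forall fun x y hy => ?_
    simp only
    by_cases h : x ∈ s M
    · rw [if_pos h]
      have h' : x ∉ Ico c (c + L * ((2 * M : ℕ) : ℝ)) := by rw [hcK]; exact h
      rw [gridCell_of_notMem h', hcK, mul_add, ← add_assoc, hcK] at hy
      have hx : M * L ≤ |x| := by
        by_contra! hlt
        rw [abs_lt] at hlt
        exact h ⟨hlt.1.le, hlt.2⟩
      rw [edist_dist, Real.dist_eq, Real.enorm_eq_ofReal_abs,
        show (3 : ℝ≥0∞) = ENNReal.ofReal 3 by simp, ← ENNReal.ofReal_mul (by norm_num)]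
      refine ENNReal.ofReal_le_ofReal ((abs_sub y x).trans ?_)
      rw [abs_of_nonneg (by linarith [hy.1] : 0 ≤ y)]
      linarith [hy.2]
    · rw [if_neg h]
      refine edist_gridCell_le hL ?_ hy
      rw [hcK]
      exact not_not.1 h
  · calc _ ≤ ∫⁻ x, (ENNReal.ofReal L ^ p + (s M).indicator (fun x => (3 * ‖x‖ₑ) ^ p) x) ∂ρ := by
          refine lintegral_mono fun x => ?_
          by_cases h : x ∈ s M
          · simp [h]
          · simp [h]
      _ = ENNReal.ofReal (ε / 2) + ∫⁻ x in s M, (3 * ‖x‖ₑ) ^ p ∂ρ := by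
          rw [lintegral_add_left measurable_const, lintegral_const, measure_univ, mul_one,
            ENNReal.ofReal_rpow_of_pos hL, hLp, lintegral_indicator (hsm M)]
      _ ≤ ENNReal.ofReal (ε / 2) + ENNReal.ofReal (ε / 2) := by gcongr
      _ = _ := by rw [← ENNReal.ofReal_add (by positivity) (by positivity), add_halves]
  · by_cases hac : ρ ≪ volume
    swap
    · simp [energy, hac]
    rw [Finset.sum_range_succ, cellMass, gridCell_preimage_last hL, hlastcell]
    refine ENNReal.ofReal_add_le.trans
      (add_le_add (le_trans (le_of_eq ?_) (sum_cell_energy_le hH hac hL (c := c) (K := 2 * M)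
        (subset_univ _))) (ENNReal.ofReal_le_ofReal hM2.le))
    congr 1
    refine Finset.sum_congr rfl fun k hk => ?_
    rw [cellMass, gridCell_preimage_of_lt hL (Finset.mem_range.1 hk)]

/-! ### Recovery sequences -/

theorem eventually_exists_particles {p : ℝ} (hp : 1 < p) {H : ℝ → ℝ} (hH : IsEnergyDensity H)
    {Ω : Set ℝ} {ρ : Measure ℝ} [IsProbabilityMeasure ρ] (hρ : ∫⁻ x, ‖x‖ₑ ^ p ∂ρ < ∞)
    (hgrid : ∀ ε, 0 < ε → HasFineGrid p Ω H ρ ε) {ε : ℝ} (hε : 0 < ε) :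
    ∀ᶠ N in atTop, ∃ x : Fin N → ℝ, StrictMono x ∧ (∀ i, x i ∈ Ω) ∧
      wassersteinDist p (empirical x) ρ ≤ ENNReal.ofReal ε ∧
      ENNReal.ofReal (particleEnergy H x) ≤ energy H Ω ρ + ENNReal.ofReal ε := by
  have hp0 : 0 < p := by linarith
  have hεp : 0 < ε ^ p := by positivity
  -- `ε / 2` serves the energy; `ε ^ p / 2` serves the `p`-th power of the distance and leaves room
  -- for a strict inequality under the limsup.
  obtain ⟨c, L, K, D, hL, hΩ, hDm, hD, hDp, hE⟩ :=
    hgrid (min (ε / 2) (ε ^ p / 2)) (lt_min (by positivity) (by positivity))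
  set κ := gridCell c L K
  have hκ : Measurable κ := measurable_gridCell
  have hn : ∀ x, κ x < K + 1 := gridCell_lt hL
  have hm0 : ∀ k, 0 ≤ cellMass ρ κ k := cellMass_nonneg
  have hm1 : ∀ k, cellMass ρ κ k ≤ 1 := cellMass_le_one
  have hcum := cumMass_cellMass (ρ := ρ) hκ hn
  have hlimsup := (limsup_lintegral_coupledParticle_le hL hκ hn hp hρ hDm hD).trans hDp
  have hlt : ENNReal.ofReal (min (ε / 2) (ε ^ p / 2)) < ENNReal.ofReal (ε ^ p) :=
    (ENNReal.ofReal_lt_ofReal_iff hεp).2 ((min_le_right _ _).trans_lt (half_lt_self hεp))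
  filter_upwards [eventually_lt_of_limsup_lt (hlimsup.trans_lt hlt), eventually_ge_atTop 2,
    eventually_particleEnergy_quantileParticles_lt (c := c) hH hL hm0 hm1 hcum
      (lt_add_of_pos_right _ (half_pos hε))] with N h1 h2 h3
  refine ⟨quantileParticles c L (cellMass ρ κ) N, quantileParticles_strictMono hL hm0 hm1 hcum N,
    fun i => hΩ ?_, ?_, ?_⟩
  · have := stepQuantile_mem_Icc (c := c) hL hm0 (n := K + 1) (s := (i : ℝ) / N) (by positivity)
      (hcum ▸ Fin.cast_div_lt_one i)
    simpa [quantileParticles] using this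
  · refine (wassersteinDist_quantileParticles_le c L hκ hn p (by lia)).trans ?_
    refine (ENNReal.rpow_le_rpow h1.le (by positivity)).trans_eq ?_
    rw [← ENNReal.ofReal_rpow_of_pos hε, ← ENNReal.rpow_mul, one_div, mul_inv_cancel₀ hp0.ne',
      ENNReal.rpow_one]
  · calc _ ≤ _ := ENNReal.ofReal_le_ofReal h3.le
      _ ≤ _ := ENNReal.ofReal_add_le
      _ ≤ energy H Ω ρ + ENNReal.ofReal (ε / 2) + ENNReal.ofReal (ε / 2) := by
          gcongr
          refine hE.trans ?_
          gcongr
          exact min_le_left _ _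
      _ = _ := by
          rw [add_assoc, ← ENNReal.ofReal_add (by positivity) (by positivity), add_halves]

theorem exists_forall_le_add {α : Type*} {A : Set α} (hA : A.Nonempty) (f : α → ℝ≥0∞) {δ : ℝ≥0∞}
    (hδ : δ ≠ 0) : ∃ x ∈ A, ∀ y ∈ A, f x ≤ f y + δ := by
  by_cases h : ⨅ y ∈ A, f y = ∞
  · obtain ⟨x, hx⟩ := hA
    refine ⟨x, hx, fun y hy => ?_⟩
    simp only [iInf_eq_top] at h
    simp [h y hy]
  · obtain ⟨x, hx, hlt⟩ : ∃ x ∈ A, f x < (⨅ y ∈ A, f y) + δ := by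
      simpa only [iInf_lt_iff, exists_prop] using ENNReal.lt_add_right h hδ
    exact ⟨x, hx, fun y hy => hlt.le.trans (by gcongr; exact iInf₂_le y hy)⟩

/-- Guarantees competitors for every `N`, including those for which no good approximation is
available yet. -/
theorem IsAdmissibleDomain.exists_strictMono {Ω : Set ℝ} (hΩ : IsAdmissibleDomain Ω) (N : ℕ) :
    ∃ x : Fin N → ℝ, StrictMono x ∧ ∀ i, x i ∈ Ω := by
  obtain ⟨a, b, hab, hsub⟩ : ∃ a b : ℝ, a < b ∧ Icc a b ⊆ Ω := by
    rcases hΩ with rfl | ⟨a, b, hab, rfl⟩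
    · exact ⟨0, 1, one_pos, subset_univ _⟩
    · exact ⟨a, b, hab, Subset.rfl⟩
  have hl : 0 < b - a := sub_pos.2 hab
  refine ⟨fun i => a + (b - a) * (i / N), fun i j hij => ?_, fun i => hsub ⟨?_, ?_⟩⟩
  · have hN : (0 : ℝ) < N := by exact_mod_cast i.pos
    have : (i : ℝ) < j := by exact_mod_cast hij
    simp only
    gcongr
  · have : 0 ≤ (b - a) * ((i : ℝ) / N) := by positivity
    linarith
  · have := mul_le_of_le_one_right hl.le (Fin.cast_div_lt_one i).le
    linarith

theorem exists_recovery_sequence {p : ℝ} (hp : 1 < p) {Ω : Set ℝ} (hΩ : IsAdmissibleDomain Ω)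
    {H : ℝ → ℝ} (hH : IsEnergyDensity H) {ρ : Measure ℝ} (hρ : ρ ∈ ProbP p Ω) :
    ∃ μ : ℕ → Measure ℝ, (∀ N, 2 ≤ N → μ N ∈ Atomic N Ω) ∧
      Tendsto (fun N => wassersteinDist p (μ N) ρ) atTop (𝓝 0) ∧
      limsup (fun N => discreteEnergy H N (μ N)) atTop ≤ energy H Ω ρ := by
  obtain ⟨hprob, hsupp, hmom⟩ := hρ
  have hgrid : ∀ ε, 0 < ε → HasFineGrid p Ω H ρ ε := by
    intro ε hε
    rcases hΩ with rfl | ⟨a, b, hab, rfl⟩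
    · exact hasFineGrid_univ hp hH hmom hε
    · exact hasFineGrid_Icc hp hH hab hsupp hε
  set A : ∀ N : ℕ, Set (Fin N → ℝ) := fun N => {x | StrictMono x ∧ ∀ i, x i ∈ Ω}
  -- Truncated subtraction keeps only the excess energy, and it is zero when the energy of `ρ` is
  -- infinite. Near-minimisers of this cost are good for all tolerances at once.
  set cost : ∀ N : ℕ, (Fin N → ℝ) → ℝ≥0∞ := fun N x =>
    wassersteinDist p (empirical x) ρ + (ENNReal.ofReal (particleEnergy H x) - energy H Ω ρ)
  have hδ : ∀ N : ℕ, ((N : ℝ≥0∞) + 1)⁻¹ ≠ 0 := fun N => by simp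
  choose x hxA hx using fun N : ℕ =>
    exists_forall_le_add (hΩ.exists_strictMono N : (A N).Nonempty) (cost N) (hδ N)
  have hcost : Tendsto (fun N => cost N (x N)) atTop (𝓝 0) := by
    have hδ0 : Tendsto (fun N : ℕ => ((N : ℝ≥0∞) + 1)⁻¹) atTop (𝓝 0) := by
      have := ENNReal.tendsto_inv_nat_nhds_zero.comp (tendsto_add_atTop_nat 1)
      simpa [Function.comp_def] using this
    rw [ENNReal.tendsto_nhds_zero]
    intro ε hε
    obtain ⟨r, hr0, hr⟩ := ENNReal.lt_iff_exists_nnreal_btwn.1 hε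
    have hr0' : (0 : ℝ) < r := by exact_mod_cast hr0
    filter_upwards [eventually_exists_particles hp hH hmom hgrid (by positivity : (0 : ℝ) < r / 3),
      (ENNReal.tendsto_nhds_zero.1 hδ0) (ENNReal.ofReal (r / 3)) (by simpa using hr0)]
      with N hN hN'
    obtain ⟨y, hy1, hy2, hy3, hy4⟩ := hN
    calc _ ≤ cost N y + ((N : ℝ≥0∞) + 1)⁻¹ := hx N y ⟨hy1, hy2⟩
      _ ≤ ENNReal.ofReal (r / 3) + ENNReal.ofReal (r / 3) + ENNReal.ofReal (r / 3) := by
          gcongr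
          exact add_le_add hy3 (tsub_le_iff_left.2 hy4)
      _ = r := by
          rw [← ENNReal.ofReal_add (by positivity) (by positivity),
            ← ENNReal.ofReal_add (by positivity) (by positivity), ← ENNReal.ofReal_coe_nnreal]
          congr 1
          ring
      _ ≤ ε := hr.le
  refine ⟨fun N => empirical (x N), fun N _ => ⟨x N, (hxA N).1, (hxA N).2, rfl⟩,
    tendsto_of_tendsto_of_tendsto_of_le_of_le tendsto_const_nhds hcost (fun _ => zero_le)
      fun N => le_self_add, ?_⟩
  have hlim : Tendsto (fun N => energy H Ω ρ + cost N (x N)) atTop (𝓝 (energy H Ω ρ)) := by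
    simpa using tendsto_const_nhds.add hcost
  rw [← hlim.limsup_eq]
  refine limsup_le_limsup (Eventually.of_forall fun N => ?_)
  simp only
  rw [discreteEnergy_empirical H (hxA N).1]
  exact le_add_tsub.trans (by gcongr; exact le_add_self)

end ParticleGamma

theorem theorem4p2 (p : ℝ) (hp : 1 < p) (Ω : Set ℝ) (hΩ : ParticleGamma.IsAdmissibleDomain Ω)
    (H : ℝ → ℝ) (hH : ParticleGamma.IsEnergyDensity H)
    (hscal : ParticleGamma.ScalingCondition H) :
    ParticleGamma.GammaConverges p Ω (fun N => ParticleGamma.discreteEnergy H N)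
      (ParticleGamma.energy H Ω) := by
  intro ρ hρ
  have : IsProbabilityMeasure ρ := hρ.1
  exact ⟨fun μ hμ h => ParticleGamma.energy_le_liminf hp hH hμ h,
    ParticleGamma.exists_recovery_sequence hp hΩ hH hρ⟩
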